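/- **Conventions.** A *cocomplete tensor category* is a symmetric monoidal category $\mathcal C$ with all small colimits such that $\otimes$ preserves small colimits in each variable; its unit is denoted $\mathcal O_{\mathcal C}$. These form a 2-category, whose 1-morphisms are the *cocontinuous tensor functors* (strong symmetric monoidal functors preserving small colimits) and whose 2-morphisms are the monoidal natural transformations. For a commutative ring $K$, the 2-category of cocomplete $K$-linear tensor categories is defined in the same way, with $K$-linear categories, $\otimes$ being $K$-linear in each variable, and $K$-linear functors. A *locally finitely presentable tensor category* is a cocomplete tensor category whose underlying category is locally finitely presentable, and whose finitely presentable objects are closed under finite tensor products (in particular, $\mathcal O_{\mathcal C}$ is finitely presentable). An *idal* is a morphism $e : I \to \mathcal O_{\mathcal C}$ with $e \otimes I = I \otimes e : I \otimes I \to I$; it is *finitely presentable* if $I$ is. The product of idals $e : I \to \mathcal O_{\mathcal C}$, $f : J \to \mathcal O_{\mathcal C}$ is $e \otimes f : I \otimes J \to \mathcal O_{\mathcal C}$. Two idals $e, f$ form a *cover* if the square formed by $e \otimes J : I \otimes J \to J$, $I \otimes f : I \otimes J \to I$, $f : J \to \mathcal O_{\mathcal C}$, $e : I \to \mathcal O_{\mathcal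 C}$ is a pushout. A *localization* of $\mathcal C$ at an idal $e : I \to \mathcal O_{\mathcal C}$ is a cocomplete tensor category $\mathcal C_I$ with a cocontinuous tensor functor $R_I : \mathcal C \to \mathcal C_I$ such that $R_I(e)$ is an isomorphism, every cocontinuous tensor functor $F : \mathcal C \to \mathcal D$ for which $F(e)$ is an isomorphism satisfies $F \cong G \circ R_I$ for some cocontinuous tensor functor $G : \mathcal C_I \to \mathcal D$, and for all cocontinuous tensor functors $G, H : \mathcal C_I \to \mathcal D$ every morphism of tensor functors $G \circ R_I \to H \circ R_I$ is induced by a unique morphism of tensor functors $G \to H$. **Theorem.** Let $\mathcal C$ be a locally finitely presentable tensor category, and let $I \to \mathcal O_{\mathcal C} \leftarrow J$ be a cover consisting of two finitely presentable idals. Then there are localizations $R_I : \mathcal C \to \mathcal C_I$, $R_J : \mathcal C \to \mathcal C_J$, $R_{I \otimes J} : \mathcal C \to \mathcal C_{I \otimes J}$ and cocontinuous tensor functors $\overline R_J : \mathcal C_I \to \mathcal C_{I \otimes J}$, $\overline R_I : \mathcal C_J \to \mathcal C_{I \otimes J}$ with isomorphisms of tensor functors $\overline R_J \circ R_I \cong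 R_{I \otimes J} \cong \overline R_I \circ R_J$. For every choice of these data: 1. The resulting square is a bicategorical pullback square in the 2-category of cocomplete tensor categories, i.e. $\mathcal C \simeq \mathcal C_I \times_{\mathcal C_{I \otimes J}} \mathcal C_J$: for every cocomplete tensor category $\mathcal T$, the category of cocontinuous tensor functors $\mathcal T \to \mathcal C$ is equivalent, via composition with $R_I$ and $R_J$, to the category of triples $(a, b, \tau)$ consisting of cocontinuous tensor functors $a : \mathcal T \to \mathcal C_I$, $b : \mathcal T \to \mathcal C_J$ and an isomorphism of tensor functors $\tau : \overline R_J \circ a \cong \overline R_I \circ b$. 2. On underlying categories, $M \mapsto (R_I M, R_J M, \overline R_J R_I M \cong \overline R_I R_J M)$ is an equivalence from $\mathcal C$ to the category of triples $(A, B, \tau)$ with $A \in \mathcal C_I$, $B \in \mathcal C_J$ and $\tau : \overline R_J A \cong \overline R_I B$. Here objects are glued as fiber products: the functors $R_I, R_J, R_{I \otimes J}$ have fully faithful right adjoints, by which we view $\mathcal C_I, \mathcal C_J, \mathcal C_{I \otimes J}$ as reflective subcategories of $\mathcal C$; every $M \in \mathcal C$ is the fiber product in $\mathcal C$ of $R_I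 M$ and $R_J M$ over $R_{I \otimes J} M$; and for every triple $(A, B, \tau)$ and every fiber product $P$ in $\mathcal C$ of $A \to \overline R_J A$ and $B \to \overline R_I B$ along $\tau$, the morphisms $R_I P \to A$ and $R_J P \to B$ corresponding to the projections are isomorphisms. The same holds in the linear case: if $K$ is a commutative ring and $\mathcal C$ is moreover $K$-linear, with $\otimes$ $K$-linear in each variable, then all of the above holds in the 2-category of cocomplete $K$-linear tensor categories, with the localizations and the bicategorical pullback taken in that 2-category. -/

import Mathlib

open CategoryTheory Limits

universe w v u

namespace IdalGluing

/-! ### Bicategorical notions -/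

section Bicategorical

open Bicategory

universe w' v' u'

variable {B : Type u'} [Bicategory.{w', v'} B]

/-- `R : C ⟶ L` exhibits `L` as the localization of `C` with respect to the class `W` of
1-morphisms out of `C` (those which invert what is to be inverted): `R` is in `W`, every `F` in `W`
factors through `R` up to isomorphism, and precomposition with `R` is fully faithful on
2-morphisms. -/
structure IsLocalizationAt {C L : B} (W : ∀ ⦃D : B⦄, (C ⟶ D) → Prop) (R : C ⟶ L) : Prop where
  mem : W R
  exists_lift : ∀ ⦃D : B⦄ (F : C ⟶ D), W F → ∃ G : L ⟶ D, Nonempty (R ≫ G ≅ F)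
  existsUnique_lift : ∀ ⦃D : B⦄ (G H : L ⟶ D) (θ : R ≫ G ⟶ R ≫ H),
    ∃! η : G ⟶ H, R ◁ η = θ

/-- The comparison functor from `T ⟶ P` to the category of triples `(a, b, τ)` consisting of
`a : T ⟶ X`, `b : T ⟶ Y` and an invertible 2-morphism `τ : a ≫ h ≅ b ≫ k`, induced by a square
commuting up to the invertible 2-morphism `σ`. -/
@[simps]
def bicategoricalPullbackComparison {P X Y Z : B} {f : P ⟶ X} {g : P ⟶ Y} {h : X ⟶ Z} {k : Y ⟶ Z}
    (σ : f ≫ h ≅ g ≫ k) (T : B) :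
    (T ⟶ P) ⥤ CategoricalPullback (postcomp T h) (postcomp T k) where
  obj t :=
    { fst := t ≫ f
      snd := t ≫ g
      iso := α_ t f h ≪≫ whiskerLeftIso t σ ≪≫ (α_ t g k).symm }
  map η :=
    { fst := η ▷ f
      snd := η ▷ g
      w := by
        change η ▷ f ▷ h ≫ ((α_ _ f h).hom ≫ _ ◁ σ.hom ≫ (α_ _ g k).inv) =
          ((α_ _ f h).hom ≫ _ ◁ σ.hom ≫ (α_ _ g k).inv) ≫ η ▷ g ▷ k
        simp only [Category.assoc]
        rw [associator_naturality_left_assoc, ← Bicategory.whisker_exchange_assoc,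
          associator_inv_naturality_left] }

/-- A square commuting up to an invertible 2-morphism `σ` is a bicategorical pullback if all the
comparison functors are equivalences of categories. -/
def IsBicategoricalPullback {P X Y Z : B} {f : P ⟶ X} {g : P ⟶ Y} {h : X ⟶ Z} {k : Y ⟶ Z}
    (σ : f ≫ h ≅ g ≫ k) : Prop :=
  ∀ T : B, (bicategoricalPullbackComparison σ T).IsEquivalence

/-- Localizations `C₁`, `C₂`, `C₁₂` of `C` at `W₁`, `W₂`, `W₁₂`, together with 1-morphisms
`C₁ ⟶ C₁₂` and `C₂ ⟶ C₁₂` under `C` (up to isomorphism). -/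
structure LocalizationSquare (C : B) (W₁ W₂ W₁₂ : ∀ ⦃D : B⦄, (C ⟶ D) → Prop) where
  C₁ : B
  C₂ : B
  C₁₂ : B
  R₁ : C ⟶ C₁
  R₂ : C ⟶ C₂
  R₁₂ : C ⟶ C₁₂
  isLocalization₁ : IsLocalizationAt W₁ R₁
  isLocalization₂ : IsLocalizationAt W₂ R₂
  isLocalization₁₂ : IsLocalizationAt W₁₂ R₁₂
  res₁ : C₁ ⟶ C₁₂
  res₂ : C₂ ⟶ C₁₂
  iso₁ : R₁ ≫ res₁ ≅ R₁₂
  iso₂ : R₂ ≫ res₂ ≅ R₁₂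

/-- The invertible 2-morphism filling the square. -/
def LocalizationSquare.iso {C : B} {W₁ W₂ W₁₂ : ∀ ⦃D : B⦄, (C ⟶ D) → Prop}
    (S : LocalizationSquare C W₁ W₂ W₁₂) : S.R₁ ≫ S.res₁ ≅ S.R₂ ≫ S.res₂ :=
  S.iso₁ ≪≫ S.iso₂.symm

end Bicategorical

open MonoidalCategory

/-! ### Gluing of objects, on the level of categories -/

section Gluing

universe v₀ v₁ v₂ v₃ u₀ u₁ u₂ u₃

variable {C : Type u₀} [Category.{v₀} C] {C₁ : Type u₁} [Category.{v₁} C₁]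
  {C₂ : Type u₂} [Category.{v₂} C₂] {C₁₂ : Type u₃} [Category.{v₃} C₁₂]

/-- The functor `M ↦ (R₁ M, R₂ M, R₁ M|₁₂ ≅ R₂ M|₁₂)` to the category of triples. -/
@[simps]
def toTriples {R₁ : C ⥤ C₁} {R₂ : C ⥤ C₂} {Q₁ : C₁ ⥤ C₁₂} {Q₂ : C₂ ⥤ C₁₂}
    (σ : R₁ ⋙ Q₁ ≅ R₂ ⋙ Q₂) : C ⥤ CategoricalPullback Q₁ Q₂ where
  obj M := { fst := R₁.obj M, snd := R₂.obj M, iso := σ.app M }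
  map φ :=
    { fst := R₁.map φ
      snd := R₂.map φ
      w := σ.hom.naturality φ }

/-- If `R ⊣ ι` and `R' ⊣ ι'` are (reflective) localizations of `C` and `i : R ⋙ Q ≅ R'`, this is the
canonical morphism `ι A ⟶ ι' (Q A)`; it corresponds to
`R' (ι A) ≅ Q (R (ι A)) ⟶ Q A`. -/
def restrictionMap {D : Type u₁} [Category.{v₁} D] {E : Type u₂} [Category.{v₂} E]
    {R : C ⥤ D} {R' : C ⥤ E} {Q : D ⥤ E} (i : R ⋙ Q ≅ R')
    {ι : D ⥤ C} {ι' : E ⥤ C} (adj : R ⊣ ι) (adj' : R' ⊣ ι') (A : D) :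
    ι.obj A ⟶ ι'.obj (Q.obj A) :=
  adj'.homEquiv _ _ (i.inv.app (ι.obj A) ≫ Q.map (adj.counit.app A))

/-- Objects of `C` are the same as triples `(A, B, τ)` via `M ↦ (R₁ M, R₂ M, can)`, where `C₁`, `C₂`
and `C₁₂` are viewed as full subcategories of `C` by means of the right adjoints `ι₁`, `ι₂`, `ι₁₂`
of `R₁`, `R₂`, `R₁₂`, and in the inverse direction a triple `(A, B, τ)` is glued as the fiber product
of `A` and `B` over `Q₁ A ≅ Q₂ B` in `C`. -/
structure GluesObjects {R₁ : C ⥤ C₁} {R₂ : C ⥤ C₂} {R₁₂ : C ⥤ C₁₂} {Q₁ : C₁ ⥤ C₁₂} {Q₂ : C₂ ⥤ C₁₂}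
    (i₁ : R₁ ⋙ Q₁ ≅ R₁₂) (i₂ : R₂ ⋙ Q₂ ≅ R₁₂) : Prop where
  isEquivalence : (toTriples (i₁ ≪≫ i₂.symm)).IsEquivalence
  reflective₁ : ∃ (ι₁ : C₁ ⥤ C) (_ : R₁ ⊣ ι₁), ι₁.Full ∧ ι₁.Faithful
  reflective₂ : ∃ (ι₂ : C₂ ⥤ C) (_ : R₂ ⊣ ι₂), ι₂.Full ∧ ι₂.Faithful
  reflective₁₂ : ∃ (ι₁₂ : C₁₂ ⥤ C) (_ : R₁₂ ⊣ ι₁₂), ι₁₂.Full ∧ ι₁₂.Faithful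
  /-- Every object `M` is the fiber product of `R₁ M` and `R₂ M` over `R₁₂ M`. -/
  isPullback_unit : ∀ {ι₁ : C₁ ⥤ C} {ι₂ : C₂ ⥤ C} {ι₁₂ : C₁₂ ⥤ C}
    (adj₁ : R₁ ⊣ ι₁) (adj₂ : R₂ ⊣ ι₂) (adj₁₂ : R₁₂ ⊣ ι₁₂) (M : C),
    IsPullback (adj₁.unit.app M) (adj₂.unit.app M)
      (restrictionMap i₁ adj₁ adj₁₂ (R₁.obj M) ≫ ι₁₂.map (i₁.hom.app M))
      (restrictionMap i₂ adj₂ adj₁₂ (R₂.obj M) ≫ ι₁₂.map (i₂.hom.app M))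
  /-- If `P` with projections `p` and `q` is the fiber product of `A` and `B` along `τ`, then the
  induced morphisms `R₁ P ⟶ A` and `R₂ P ⟶ B` are isomorphisms. -/
  isIso_of_isPullback : ∀ {ι₁ : C₁ ⥤ C} {ι₂ : C₂ ⥤ C} {ι₁₂ : C₁₂ ⥤ C}
    (adj₁ : R₁ ⊣ ι₁) (adj₂ : R₂ ⊣ ι₂) (adj₁₂ : R₁₂ ⊣ ι₁₂)
    (A : C₁) (B : C₂) (τ : Q₁.obj A ≅ Q₂.obj B) (P : C)
    (p : P ⟶ ι₁.obj A) (q : P ⟶ ι₂.obj B),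
    IsPullback p q (restrictionMap i₁ adj₁ adj₁₂ A ≫ ι₁₂.map τ.hom)
      (restrictionMap i₂ adj₂ adj₁₂ B) →
    IsIso ((adj₁.homEquiv P A).symm p) ∧ IsIso ((adj₂.homEquiv P B).symm q)

end Gluing

/-! ### The 2-category of cocomplete tensor categories -/

set_option linter.checkUnivs false in
/-- A cocomplete tensor category: a symmetric monoidal category with all small colimits whose tensor
product preserves small colimits in each variable. -/
structure CocompleteTensorCat : Type (max (u + 1) (v + 1)) where
  carrier : Type u
  [category : Category.{v} carrier]
  [monoidalCategory : MonoidalCategory carrier]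
  [symmetricCategory : SymmetricCategory carrier]
  [hasColimits : HasColimits carrier]
  [tensorLeft_preservesColimits : ∀ X : carrier, PreservesColimits (tensorLeft X)]
  [tensorRight_preservesColimits : ∀ X : carrier, PreservesColimits (tensorRight X)]

namespace CocompleteTensorCat

instance : CoeSort CocompleteTensorCat.{v, u} (Type u) := ⟨carrier⟩

attribute [instance] category monoidalCategory symmetricCategory hasColimits
  tensorLeft_preservesColimits tensorRight_preservesColimits

/-- A cocontinuous tensor functor: a strong symmetric monoidal functor preserving small colimits. -/
structure Hom (C D : CocompleteTensorCat.{v, u}) where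
  functor : C ⥤ D
  [braided : functor.Braided]
  [preservesColimits : PreservesColimits functor]

attribute [instance] Hom.braided Hom.preservesColimits

/-- A morphism of tensor functors: a monoidal natural transformation. -/
@[ext]
structure Hom₂ {C D : CocompleteTensorCat.{v, u}} (F G : Hom C D) where
  natTrans : F.functor ⟶ G.functor
  [isMonoidal : NatTrans.IsMonoidal natTrans]

attribute [instance] Hom₂.isMonoidal

@[simps id_functor comp_functor]
instance : CategoryStruct CocompleteTensorCat.{v, u} where
  Hom := Hom
  id C := { functor := 𝟭 C }
  comp F G := { functor := F.functor ⋙ G.functor }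

@[simps id_natTrans comp_natTrans]
instance homCategory (C D : CocompleteTensorCat.{v, u}) : Category (C ⟶ D) where
  Hom F G := Hom₂ F G
  id F := { natTrans := 𝟙 F.functor }
  comp η θ := { natTrans := η.natTrans ≫ θ.natTrans }

section

variable {C D E E' : CocompleteTensorCat.{v, u}}

@[ext]
lemma hom₂_ext {F G : C ⟶ D} {η θ : F ⟶ G} (h : η.natTrans = θ.natTrans) : η = θ :=
  Hom₂.ext h

/-- A monoidal natural isomorphism is an isomorphism of tensor functors. -/
@[simps]
def isoMk {F G : C ⟶ D} (φ : F.functor ≅ G.functor) (h : NatTrans.IsMonoidal φ.hom) : F ≅ G where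
  hom := { natTrans := φ.hom }
  inv := { natTrans := φ.inv }

/-- The functor which forgets everything but the underlying functors. -/
@[simps]
def forget (C D : CocompleteTensorCat.{v, u}) : (C ⟶ D) ⥤ (C ⥤ D) where
  obj F := F.functor
  map η := η.natTrans

@[simps]
def whiskerLeft (F : C ⟶ D) {G H : D ⟶ E} (η : G ⟶ H) : F ≫ G ⟶ F ≫ H where
  natTrans := Functor.whiskerLeft F.functor η.natTrans
  isMonoidal := NatTrans.IsMonoidal.whiskerLeft (F₁ := F.functor) η.natTrans

@[simps]
def whiskerRight {F G : C ⟶ D} (η : F ⟶ G) (H : D ⟶ E) : F ≫ H ⟶ G ≫ H where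
  natTrans := Functor.whiskerRight η.natTrans H.functor
  isMonoidal := NatTrans.IsMonoidal.whiskerRight η.natTrans (G₁ := H.functor)

@[simps!]
def associator (F : C ⟶ D) (G : D ⟶ E) (H : E ⟶ E') : (F ≫ G) ≫ H ≅ F ≫ G ≫ H :=
  isoMk (F := (F ≫ G) ≫ H) (G := F ≫ G ≫ H)
    (Functor.associator F.functor G.functor H.functor)
    (inferInstanceAs (NatTrans.IsMonoidal
      (Functor.associator F.functor G.functor H.functor).hom))

@[simps!]
def leftUnitor (F : C ⟶ D) : 𝟙 C ≫ F ≅ F :=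
  isoMk (F := 𝟙 C ≫ F) (G := F) F.functor.leftUnitor
    (inferInstanceAs (NatTrans.IsMonoidal F.functor.leftUnitor.hom))

@[simps!]
def rightUnitor (F : C ⟶ D) : F ≫ 𝟙 D ≅ F :=
  isoMk (F := F ≫ 𝟙 D) (G := F) F.functor.rightUnitor
    (inferInstanceAs (NatTrans.IsMonoidal F.functor.rightUnitor.hom))

end

instance : Bicategory CocompleteTensorCat.{v, u} where
  homCategory := homCategory
  whiskerLeft F _ _ η := whiskerLeft F η
  whiskerRight η H := whiskerRight η H
  associator := associator
  leftUnitor := leftUnitor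
  rightUnitor := rightUnitor

/-- The natural isomorphism of underlying functors of an isomorphism of tensor functors. -/
def underlyingIso {C D E : CocompleteTensorCat.{v, u}} {R : C ⟶ D} {Q : D ⟶ E} {R' : C ⟶ E}
    (i : R ≫ Q ≅ R') : R.functor ⋙ Q.functor ≅ R'.functor :=
  (forget C E).mapIso i

/-- The functor `F` maps `e` to an isomorphism. -/
def Inverts {C : CocompleteTensorCat.{v, u}} {X Y : C} (e : X ⟶ Y)
    ⦃D : CocompleteTensorCat.{v, u}⦄ (F : C ⟶ D) : Prop :=
  IsIso (F.functor.map e)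

end CocompleteTensorCat

/-! ### The 2-category of cocomplete `K`-linear tensor categories -/

set_option linter.checkUnivs false in
/-- A cocomplete `K`-linear tensor category: a cocomplete tensor category whose underlying category
is `K`-linear and whose tensor product is `K`-linear in each variable. -/
structure LinearCocompleteTensorCat (K : Type w) [CommRing K] :
    Type (max w (u + 1) (v + 1)) where
  toTensorCat : CocompleteTensorCat.{v, u}
  [preadditive : Preadditive toTensorCat]
  [linear : Linear K toTensorCat]
  [monoidalPreadditive : MonoidalPreadditive toTensorCat]
  [monoidalLinear : MonoidalLinear K toTensorCat]

namespace LinearCocompleteTensorCat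

variable {K : Type w} [CommRing K]

instance : CoeSort (LinearCocompleteTensorCat.{w, v, u} K) (Type u) := ⟨fun C => C.toTensorCat⟩

attribute [instance] preadditive linear monoidalPreadditive monoidalLinear

/-- A cocontinuous `K`-linear tensor functor. -/
structure Hom (C D : LinearCocompleteTensorCat.{w, v, u} K) where
  toTensor : C.toTensorCat ⟶ D.toTensorCat
  [additive : toTensor.functor.Additive]
  [linear : toTensor.functor.Linear K]

attribute [instance] Hom.additive Hom.linear

/-- The 2-morphisms are all morphisms of tensor functors. -/
@[ext]
structure Hom₂ {C D : LinearCocompleteTensorCat.{w, v, u} K} (F G : Hom C D) where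
  toTensor : F.toTensor ⟶ G.toTensor

@[simps id_toTensor comp_toTensor]
instance : CategoryStruct (LinearCocompleteTensorCat.{w, v, u} K) where
  Hom := Hom
  id C :=
    { toTensor := 𝟙 C.toTensorCat
      additive := inferInstanceAs (𝟭 C.toTensorCat).Additive
      linear := inferInstanceAs ((𝟭 C.toTensorCat).Linear K) }
  comp F G :=
    { toTensor := F.toTensor ≫ G.toTensor
      additive := inferInstanceAs (F.toTensor.functor ⋙ G.toTensor.functor).Additive
      linear := inferInstanceAs ((F.toTensor.functor ⋙ G.toTensor.functor).Linear K) }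

@[simps id_toTensor comp_toTensor]
instance homCategory (C D : LinearCocompleteTensorCat.{w, v, u} K) : Category (C ⟶ D) where
  Hom F G := Hom₂ F G
  id F := { toTensor := 𝟙 F.toTensor }
  comp η θ := { toTensor := η.toTensor ≫ θ.toTensor }

section

variable {C D : LinearCocompleteTensorCat.{w, v, u} K}

@[ext]
lemma hom₂_ext {F G : C ⟶ D} {η θ : F ⟶ G} (h : η.toTensor = θ.toTensor) : η = θ :=
  Hom₂.ext h

@[simps]
def isoMk {F G : C ⟶ D} (φ : F.toTensor ≅ G.toTensor) : F ≅ G where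
  hom := { toTensor := φ.hom }
  inv := { toTensor := φ.inv }

/-- The functor which forgets linearity. -/
@[simps]
def forget (C D : LinearCocompleteTensorCat.{w, v, u} K) :
    (C ⟶ D) ⥤ (C.toTensorCat ⟶ D.toTensorCat) where
  obj F := F.toTensor
  map η := η.toTensor

end

open Bicategory in
instance : Bicategory (LinearCocompleteTensorCat.{w, v, u} K) where
  homCategory := homCategory
  whiskerLeft F _ _ η := Hom₂.mk (F.toTensor ◁ η.toTensor)
  whiskerRight η H := Hom₂.mk (η.toTensor ▷ H.toTensor)
  associator F G H := isoMk (F := (F ≫ G) ≫ H) (G := F ≫ G ≫ H)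
    (α_ F.toTensor G.toTensor H.toTensor)
  leftUnitor {C _} F := isoMk (F := 𝟙 C ≫ F) (G := F) (λ_ F.toTensor)
  rightUnitor {_ D} F := isoMk (F := F ≫ 𝟙 D) (G := F) (ρ_ F.toTensor)
  whisker_exchange η θ := hom₂_ext (Bicategory.whisker_exchange η.toTensor θ.toTensor)

/-- The natural isomorphism of underlying functors of an isomorphism of tensor functors. -/
def underlyingIso {C D E : LinearCocompleteTensorCat.{w, v, u} K} {R : C ⟶ D} {Q : D ⟶ E}
    {R' : C ⟶ E} (i : R ≫ Q ≅ R') :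
    R.toTensor.functor ⋙ Q.toTensor.functor ≅ R'.toTensor.functor :=
  CocompleteTensorCat.underlyingIso ((forget C E).mapIso i)

/-- The functor `F` maps `e` to an isomorphism. -/
def Inverts {C : LinearCocompleteTensorCat.{w, v, u} K} {X Y : C} (e : X ⟶ Y)
    ⦃D : LinearCocompleteTensorCat.{w, v, u} K⦄ (F : C ⟶ D) : Prop :=
  IsIso (F.toTensor.functor.map e)

end LinearCocompleteTensorCat

/-! ### Idals -/

section Idals

variable {C : Type u} [Category.{v} C] [MonoidalCategory C]

/-- A morphism `e : I ⟶ 𝟙_ C` is an idal if `e ⊗ I = I ⊗ e` as morphisms `I ⊗ I ⟶ I`. -/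
def IsIdal {I : C} (e : I ⟶ 𝟙_ C) : Prop :=
  e ▷ I ≫ (λ_ I).hom = I ◁ e ≫ (ρ_ I).hom

/-- The product `e ⊗ f : I ⊗ J ⟶ 𝟙_ C` of two idals. -/
def idalProd {I J : C} (e : I ⟶ 𝟙_ C) (f : J ⟶ 𝟙_ C) : I ⊗ J ⟶ 𝟙_ C :=
  (e ⊗ₘ f) ≫ (λ_ (𝟙_ C)).hom

/-- Two idals form a cover if the evident square with vertices `I ⊗ J`, `J`, `I`, `𝟙_ C` is a
pushout. -/
structure IsIdalCover {I J : C} (e : I ⟶ 𝟙_ C) (f : J ⟶ 𝟙_ C) : Prop where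
  isIdal_left : IsIdal e
  isIdal_right : IsIdal f
  isPushout : IsPushout (e ▷ J ≫ (λ_ J).hom) (I ◁ f ≫ (ρ_ I).hom) f e

variable (C) in
/-- The underlying category is locally finitely presentable, and the finitely presentable objects
are closed under finite tensor products. -/
structure IsLocallyFinitelyPresentableTensor : Prop where
  isLocallyFinitelyPresentable : IsLocallyFinitelyPresentable.{v} C
  unit : IsFinitelyPresentable.{v} (𝟙_ C)
  tensor : ∀ X Y : C, IsFinitelyPresentable.{v} X → IsFinitelyPresentable.{v} Y →
    IsFinitelyPresentable.{v} (X ⊗ Y)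

end Idals

end IdalGluing

open MonoidalCategory IdalGluing

/-!
A finitely presentable idal `e : I ⟶ 𝟙_ C` turns `S = I ⊗ -` into a well-copointed endofunctor with
copoint `ε = e ⊗ -` (`WellCopointed.ofIdal`). Inverting `e` by a tensor functor is the same as
inverting all `ε_X`, and an object `Z` is called local if it is orthogonal to all `ε_X`, that is if
`Z ⟶ T Z` is invertible, where `T = [I, -]` is the right adjoint of `S`. Because `I ⊗ -` preserves
finitely presentable objects, the colimit of `M ⟶ T M ⟶ T (T M) ⟶ ⋯` is already local
(`WellCopointed.isLocal_refl`), so that it is the reflection of `M`. The morphisms inverted by the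
reflector have an elementary description in terms of finitely presentable objects `X`: they are the
morphisms which are bijective on `X`-valued points up to composition with iterates of `ε`
(`WellCopointed.LocallyBijective`, `WellCopointed.IsReflector.isIso_map_iff`). This class is stable
under tensor products and base change. Hence the local objects form the localized tensor category
(`WellCopointed.isLocalizationAt_toLocalization`), and since localizations are unique up to
equivalence, every localization at `e` is a reflector onto the local objects.

If `e` and `f` form a cover, then every `X` is the pushout of `I ⊗ X` and `J ⊗ X` over
`I ⊗ J ⊗ X`. Therefore a morphism which is locally bijective with respect to both idals is an
isomorphism (`WellCopointed.IsCover.isIso`). As `I ⊗ -` and `J ⊗ -` commute, the reflection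
for one idal preserves local objects for the other; thus the local objects for `e ⊗ f` are those
local for both, and `A ⟶ A|₁₂` is locally bijective with respect to `f` if `A` is local for `e`. A
commutative square whose opposite sides are locally bijective with respect to `e` and `f`,
respectively, is a pullback (`WellCopointed.IsCover.isPullback`). Applied to the square of units at
`M`, this shows that `M` is the fiber product of its restrictions; and base change shows that the
fiber product of a triple restricts to the given objects (`WellCopointed.gluesObjects`).

Consequently `C` is equivalent to the category of triples via a functor whose two components are
tensor functors. A tensor functor to `C` can then be glued from tensor functors to the two
localizations: its structure morphisms are pairs of compatible structure morphisms, and their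
coherence and the preservation of colimits may be tested on both components
(`CocompleteTensorCat.isBicategoricalPullback_of_toTriples`). In the linear case the same functors
are linear, because linearity can be tested after passing to both components, respectively because a
functor on local objects is the restriction of its composition with the reflector.
-/

namespace IdalGluing

/-! ### Locally finitely presentable categories -/

section LocallyFinitelyPresentable

open Opposite

variable {C : Type u} [Category.{v} C]

/-- An adjoint functor theorem. If every object of `C` is a colimit of objects from a small class
`P`, the colimit of the objects of `P` over `A` is a solution set for maps `F Y ⟶ A`. -/
lemma isLeftAdjoint_of_colimitsOfShape {D : Type*} [Category.{v} D] [HasColimits C]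
    (P : ObjectProperty C) [ObjectProperty.Small.{v} P]
    (hP : ∀ X : C, ∃ (J : Type v) (_ : SmallCategory J), P.colimitsOfShape J X)
    (F : C ⥤ D) [PreservesColimits F] : F.IsLeftAdjoint := by
  have : HasLimits Cᵒᵖ := inferInstance
  have : PreservesLimits F.op := preservesLimits_op F
  suffices F.op.IsRightAdjoint by
    have := this
    exact ⟨_, ⟨(Adjunction.ofIsRightAdjoint F.op).unop⟩⟩
  refine isRightAdjoint_of_preservesLimits_of_solutionSetCondition _ fun ⟨A⟩ ↦ ?_
  have : Small.{v} P.FullSubcategory :=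
    small_of_injective (β := Subtype P) (f := fun X ↦ ⟨X.obj, X.property⟩)
      (fun X Y h ↦ by cases X; cases Y; simpa using h)
  have : Small.{v} (CostructuredArrow (P.ι ⋙ F) A) :=
    small_of_injective (β := Σ X : P.FullSubcategory, (F.obj X.obj ⟶ A))
      (f := fun X ↦ ⟨X.left, X.hom⟩)
      (fun X Y h ↦ by
        obtain ⟨X, ⟨⟨⟩⟩, f⟩ := X
        obtain ⟨Y, ⟨⟨⟩⟩, g⟩ := Y
        simp only [Sigma.mk.injEq] at h
        obtain ⟨rfl, h⟩ := h
        cases h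
        rfl)
  have : EssentiallySmall.{v} (CostructuredArrow (P.ι ⋙ F) A) :=
    essentiallySmall_of_small_of_locallySmall _
  have := hasColimitsOfShape_of_essentiallySmall.{v} (CostructuredArrow (P.ι ⋙ F) A) C
  let K := CostructuredArrow.proj (P.ι ⋙ F) A ⋙ P.ι
  have hF : PreservesColimitsOfShape (CostructuredArrow (P.ι ⋙ F) A) F :=
    preservesColimitsOfShape_of_equiv (equivSmallModel.{v} _).symm F
  let c : Cocone (K ⋙ F) :=
    { pt := A
      ι := { app := fun X ↦ X.hom, naturality := fun X Y f ↦
              (CostructuredArrow.w f).trans (Category.comp_id _).symm } }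
  refine ⟨PUnit, fun _ ↦ op (colimit K), fun _ ↦
    ((isColimitOfPreserves F (colimit.isColimit K)).desc c).op, fun ⟨Y⟩ h ↦ ⟨⟨⟩, ?_⟩⟩
  -- A map `F Y ⟶ A` restricts to maps `F (p.diag.obj j) ⟶ A`, which are objects of the index
  -- category of `K`; this defines the factorization over `colimit K`.
  obtain ⟨J, _, ⟨p⟩⟩ := hP Y
  let obj (j : J) : CostructuredArrow (P.ι ⋙ F) A :=
    CostructuredArrow.mk (Y := (⟨p.diag.obj j, p.prop_diag_obj j⟩ : P.FullSubcategory))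
      (F.map (p.ι.app j) ≫ h.unop)
  let s : Cocone p.diag :=
    { pt := colimit K
      ι :=
        { app := fun j ↦ colimit.ι K (obj j)
          naturality := fun i j f ↦ by
            let φ : obj i ⟶ obj j := CostructuredArrow.homMk (ObjectProperty.homMk (p.diag.map f))
              (by
                have := p.ι.naturality f
                simp only [Functor.const_obj_map, Category.comp_id, Functor.const_obj_obj] at this
                simp [obj, ← F.map_comp_assoc, this])
            exact (colimit.w K φ).trans (Category.comp_id _).symm } }
  refine ⟨(p.isColimit.desc s).op, ?_⟩
  apply Quiver.Hom.unop_inj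
  refine (isColimitOfPreserves F p.isColimit).hom_ext fun j ↦ ?_
  have h₁ := (isColimitOfPreserves F (colimit.isColimit K)).fac c (obj j)
  have h₂ := p.isColimit.fac s j
  dsimp at h₁ h₂ ⊢
  rw [← F.map_comp_assoc]
  erw [h₂]
  exact h₁

attribute [local instance] Cardinal.fact_isRegular_aleph0

lemma isLeftAdjoint_of_preservesColimits [IsLocallyFinitelyPresentable.{v} C] {D : Type*}
    [Category.{v} D] (F : C ⥤ D) [PreservesColimits F] : F.IsLeftAdjoint := by
  obtain ⟨P, _, hP⟩ := HasCardinalFilteredGenerator.exists_small_generator.{v} C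
    Cardinal.aleph0.{v}
  exact isLeftAdjoint_of_colimitsOfShape P (fun X ↦ by
    obtain ⟨J, _, _, h⟩ := hP.exists_colimitsOfShape X
    exact ⟨J, _, h⟩) F

variable (C) in
/-- Diagonal functors preserve colimits and thus have right adjoints. -/
lemma hasPullbacks_of_isLocallyFinitelyPresentable [IsLocallyFinitelyPresentable.{v} C] :
    HasPullbacks C :=
  hasLimitsOfShape_iff_isLeftAdjoint_const.2 (isLeftAdjoint_of_preservesColimits _)

variable (C) in
lemma isStrongGenerator_isFinitelyPresentable [IsLocallyFinitelyPresentable.{v} C] :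
    (ObjectProperty.isFinitelyPresentable.{v} C).IsStrongGenerator :=
  (isCardinalFilteredGenerator_isCardinalPresentable C Cardinal.aleph0.{v}).isStrongGenerator

/-- Equality of morphisms may be tested on finitely presentable objects. -/
lemma hom_ext_of_isFinitelyPresentable [IsLocallyFinitelyPresentable.{v} C] {X Y : C} {f g : X ⟶ Y}
    (h : ∀ (G : C) (_ : IsFinitelyPresentable.{v} G) (a : G ⟶ X), a ≫ f = a ≫ g) : f = g :=
  (isStrongGenerator_isFinitelyPresentable C).isSeparating _ _ fun G hG a ↦ h G hG a

lemma isIso_of_isFinitelyPresentable_bijective [IsLocallyFinitelyPresentable.{v} C]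
    {X Y : C} (f : X ⟶ Y)
    (h : ∀ (G : C) (_ : IsFinitelyPresentable.{v} G),
      Function.Bijective (fun a : G ⟶ X ↦ a ≫ f)) : IsIso f := by
  have : Mono f := ⟨fun a b hab ↦ hom_ext_of_isFinitelyPresentable fun G hG c ↦
    (h G hG).1 (by simp [hab])⟩
  exact (isStrongGenerator_isFinitelyPresentable C).isIso_of_mono f fun G hG ↦ (h G hG).2

lemma exists_hom_of_isColimit_nat {F : ℕ ⥤ C} {c : Cocone F} (hc : IsColimit c) {X : C}
    [IsFinitelyPresentable.{v} X] (f : X ⟶ c.pt) :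
    ∃ (n : ℕ) (p : X ⟶ F.obj n), p ≫ c.ι.app n = f :=
  have : PreservesFilteredColimitsOfSize.{0, 0} (coyoneda.obj (op X)) :=
    preservesFilteredColimitsOfSize_shrink.{0, v, 0, v} _
  Types.jointly_surjective_of_isColimit (isColimitOfPreserves (coyoneda.obj (op X)) hc) f

lemma exists_eq_of_isColimit_nat {F : ℕ ⥤ C} {c : Cocone F} (hc : IsColimit c) {X : C}
    [IsFinitelyPresentable.{v} X]
    {n : ℕ} (f g : X ⟶ F.obj n)
    (h : f ≫ c.ι.app n = g ≫ c.ι.app n) :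
    ∃ (k : ℕ) (hk : n ≤ k), f ≫ F.map (homOfLE hk) = g ≫ F.map (homOfLE hk) := by
  have : PreservesFilteredColimitsOfSize.{0, 0} (coyoneda.obj (op X)) :=
    preservesFilteredColimitsOfSize_shrink.{0, v, 0, v} _
  obtain ⟨k, a, b, hk⟩ := (Types.FilteredColimit.isColimit_eq_iff _
    (isColimitOfPreserves (coyoneda.obj (op X)) hc) (xi := f) (xj := g)).mp h
  exact ⟨k, leOfHom a, hk⟩

end LocallyFinitelyPresentable

/-! ### Well-copointed endofunctors and their reflections -/

section WellCopointed

open Opposite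

/-- A finitary well-copointed endofunctor `S` of `C`: a left adjoint `S` preserving finitely
presentable objects with a copoint `ε` (a natural transformation to the identity functor) such that
`S ε = ε S`. -/
structure WellCopointed (C : Type u) [Category.{v} C] where
  /-- the endofunctor -/
  S : C ⥤ C
  /-- its right adjoint -/
  T : C ⥤ C
  adj : S ⊣ T
  /-- the copoint -/
  ε (X : C) : S.obj X ⟶ X
  ε_naturality {X Y : C} (f : X ⟶ Y) : S.map f ≫ ε Y = ε X ≫ f
  map_ε (X : C) : S.map (ε X) = ε (S.obj X)
  isFinitelyPresentable_obj (X : C) (hX : IsFinitelyPresentable.{v} X) :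
    IsFinitelyPresentable.{v} (S.obj X)

namespace WellCopointed

variable {C : Type u} [Category.{v} C] (E : WellCopointed C)

/-- The point of the right adjoint which is conjugate to `ε`. -/
def η (M : C) : M ⟶ E.T.obj M := E.adj.homEquiv M M (E.ε M)

lemma homEquiv_ε_comp {X Z : C} (a : X ⟶ Z) :
    E.adj.homEquiv X Z (E.ε X ≫ a) = a ≫ E.η Z := by
  rw [← E.ε_naturality, E.adj.homEquiv_naturality_left]
  rfl

lemma η_naturality {X Y : C} (f : X ⟶ Y) : f ≫ E.η Y = E.η X ≫ E.T.map f := by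
  rw [← homEquiv_ε_comp, E.adj.homEquiv_naturality_right]
  rfl

lemma map_η_comp_counit (M : C) : E.S.map (E.η M) ≫ E.adj.counit.app M = E.ε M := by
  rw [η, Adjunction.homEquiv_unit]
  simp

lemma counit_comp_η (M : C) : E.adj.counit.app M ≫ E.η M = E.ε (E.T.obj M) := by
  refine (E.homEquiv_ε_comp (E.adj.counit.app M)).symm.trans ?_
  change E.adj.homEquiv _ _ (E.ε (E.S.obj (E.T.obj M)) ≫ _) = _
  rw [← map_ε]
  apply (E.adj.homEquiv _ _).symm.injective
  rw [Equiv.symm_apply_apply, E.adj.homEquiv_counit]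
  rfl

/-- The right adjoint is well-pointed, since `S` is well-copointed. -/
lemma map_η (M : C) : E.T.map (E.η M) = E.η (E.T.obj M) := by
  have h := E.homEquiv_ε_comp (𝟙 (E.T.obj M))
  rw [Category.comp_id, Category.id_comp, ← counit_comp_η,
    E.adj.homEquiv_naturality_right] at h
  simpa [Adjunction.homEquiv_unit] using h

/-- `Z` is local if `η_Z` is invertible, that is if `Z` is right orthogonal to all `ε_X`. -/
def IsLocal : ObjectProperty C := fun Z ↦ IsIso (E.η Z)

variable {E}

lemma IsLocal.bijective {Z : C} (hZ : E.IsLocal Z) (X : C) :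
    Function.Bijective (fun a : X ⟶ Z ↦ E.ε X ≫ a) := by
  have : IsIso (E.η Z) := hZ
  rw [← Function.Bijective.of_comp_iff' (E.adj.homEquiv X Z).bijective]
  have : (E.adj.homEquiv X Z : _ → _) ∘ (fun a : X ⟶ Z ↦ E.ε X ≫ a) =
      fun a ↦ a ≫ E.η Z := funext fun a ↦ E.homEquiv_ε_comp a
  rw [this]
  exact ((asIso (E.η Z)).homToEquiv).bijective

variable (E)

/-- The iterates of `T` on an object. -/
def iterObj (M : C) : ℕ → C
  | 0 => M
  | n + 1 => E.T.obj (iterObj M n)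

/-- The sequence `M ⟶ T M ⟶ T (T M) ⟶ ⋯` whose transition maps are given by `η`. -/
def tower (M : C) : ℕ ⥤ C :=
  Functor.ofSequence (X := E.iterObj M) (fun n ↦ E.η (E.iterObj M n))

lemma tower_map_succ (M : C) (n : ℕ) :
    (E.tower M).map (homOfLE (Nat.le_add_right n 1)) = E.η (E.iterObj M n) :=
  Functor.ofSequence_map_homOfLE_succ _ n

/-- If `F` inverts all `ε_X`, then it inverts all `η_M`: by the two-out-of-six property applied to
`S M ⟶ S (T M) ⟶ M ⟶ T M`. -/
lemma isIso_map_η {D : Type*} [Category* D] (F : C ⥤ D) (hF : ∀ X, IsIso (F.map (E.ε X)))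
    (M : C) : IsIso (F.map (E.η M)) := by
  have h₃ := hF M
  have h₄ := hF (E.T.obj M)
  rw [← map_η_comp_counit, F.map_comp] at h₃
  rw [← counit_comp_η, F.map_comp] at h₄
  have : IsSplitEpi (F.map (E.adj.counit.app M)) :=
    ⟨⟨inv (F.map (E.S.map (E.η M)) ≫ F.map (E.adj.counit.app M)) ≫ F.map (E.S.map (E.η M)),
      by simp⟩⟩
  have : IsSplitMono (F.map (E.adj.counit.app M)) :=
    ⟨⟨F.map (E.η M) ≫ inv (F.map (E.adj.counit.app M) ≫ F.map (E.η M)),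
      by rw [← Category.assoc, IsIso.hom_inv_id]⟩⟩
  have := isIso_of_mono_of_isSplitEpi (F.map (E.adj.counit.app M))
  exact IsIso.of_isIso_comp_left (F.map (E.adj.counit.app M)) _

variable [IsLocallyFinitelyPresentable.{v} C]

variable {E} in
/-- It suffices to test orthogonality for finitely presentable objects. -/
lemma isLocal_of_bijective {Z : C} (h : ∀ (X : C) (_ : IsFinitelyPresentable.{v} X),
    Function.Bijective (fun a : X ⟶ Z ↦ E.ε X ≫ a)) : E.IsLocal Z := by
  refine isIso_of_isFinitelyPresentable_bijective _ fun X hX ↦ ?_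
  have : (fun a : X ⟶ Z ↦ a ≫ E.η Z) = (E.adj.homEquiv X Z : _ → _) ∘
      (fun a : X ⟶ Z ↦ E.ε X ≫ a) := funext fun a ↦ (E.homEquiv_ε_comp a).symm
  exact this ▸ (E.adj.homEquiv X Z).bijective.comp (h X hX)

/-- The colimit of the sequence of iterates of `T`. -/
noncomputable def refl (M : C) : C := colimit (E.tower M)

/-- The canonical map from an object to the colimit of the iterates. -/
noncomputable def toRefl (M : C) : M ⟶ E.refl M := colimit.ι (E.tower M) 0

/-- The colimit of a sequence `F` is local if every `F n` has a transition map `F n ⟶ F m` which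
factors as `F n ⟶ T (F n) ⟶ F m`, such that `T (F n) ⟶ F m ⟶ T (F m)` is `T` of the transition map:
every morphism `S X ⟶ F n` from a finitely presentable object then corresponds to `X ⟶ T (F n)` and
extends to `X ⟶ F m`. The criterion does not ask for `T` to preserve sequential colimits. -/
lemma isLocal_of_isColimit {F : ℕ ⥤ C} {c : Cocone F} (hc : IsColimit c)
    (h : ∀ n : ℕ, ∃ (m : ℕ) (hm : n ≤ m) (a : E.T.obj (F.obj n) ⟶ F.obj m),
      E.η (F.obj n) ≫ a = F.map (homOfLE hm) ∧
      a ≫ E.η (F.obj m) = E.T.map (F.map (homOfLE hm))) :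
    E.IsLocal c.pt := by
  refine isLocal_of_bijective fun X hX ↦ ⟨fun a b hab ↦ ?_, fun u ↦ ?_⟩
  · obtain ⟨n, a, rfl⟩ := exists_hom_of_isColimit_nat hc a
    obtain ⟨n', b, rfl⟩ := exists_hom_of_isColimit_nat hc b
    wlog hn : n ≤ n' generalizing n n' a b
    · exact (this n' b n a hab.symm (by lia)).symm
    rw [← c.w (homOfLE hn), ← Category.assoc] at hab ⊢
    generalize a ≫ F.map (homOfLE hn) = a at *
    have := E.isFinitelyPresentable_obj X hX
    simp only [← Category.assoc] at hab
    obtain ⟨k, hk, h₁⟩ := exists_eq_of_isColimit_nat hc _ _ hab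
    obtain ⟨m, hm, t, ht, -⟩ := h k
    have h₂ := congr(E.adj.homEquiv _ _ $h₁ ≫ t)
    simp only [Category.assoc, homEquiv_ε_comp, ht] at h₂
    rw [← c.w (homOfLE hk), ← c.w (homOfLE hm)]
    simp only [← Category.assoc] at h₂ ⊢
    rw [h₂]
  · have := E.isFinitelyPresentable_obj X hX
    obtain ⟨n, u, rfl⟩ := exists_hom_of_isColimit_nat hc u
    obtain ⟨m, hm, t, ht, ht'⟩ := h n
    refine ⟨E.adj.homEquiv _ _ u ≫ t ≫ c.ι.app m, ?_⟩
    have : E.ε X ≫ E.adj.homEquiv _ _ u ≫ t = u ≫ F.map (homOfLE hm) := by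
      apply (E.adj.homEquiv _ _).injective
      rw [homEquiv_ε_comp, Category.assoc, ht', ← E.adj.homEquiv_naturality_right]
    dsimp only
    rw [reassoc_of% this, c.w]

/-- The sequence of iterates of `T` satisfies the criterion for local colimits with
`T (Tⁿ M) = Tⁿ⁺¹ M`, because `T η = η T`. -/
lemma isLocal_refl (M : C) : E.IsLocal (E.refl M) :=
  E.isLocal_of_isColimit (colimit.isColimit (E.tower M)) fun n ↦
    ⟨n + 1, Nat.le_add_right n 1, 𝟙 _, (Category.comp_id _).trans (E.tower_map_succ M n).symm, by
      rw [tower_map_succ]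
      exact (Category.id_comp _).trans (E.map_η _).symm⟩

/-- A functor which inverts all `ε_X` and preserves sequential colimits inverts all reflections,
because it turns the sequence of iterates into a sequence of isomorphisms. -/
lemma isIso_map_toRefl {D : Type*} [Category* D] (F : C ⥤ D) [PreservesColimitsOfShape ℕ F]
    (hF : ∀ X, IsIso (F.map (E.ε X))) (M : C) : IsIso (F.map (E.toRefl M)) := by
  have hc := isColimitOfPreserves F (colimit.isColimit (E.tower M))
  have hG : ∀ (n : ℕ), IsIso ((E.tower M ⋙ F).map (homOfLE (Nat.zero_le n))) := by
    intro n
    induction n with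
    | zero => exact inferInstanceAs (IsIso ((E.tower M ⋙ F).map (𝟙 0)))
    | succ n ih =>
      have h₁ : IsIso ((E.tower M ⋙ F).map (homOfLE (Nat.le_add_right n 1))) := by
        dsimp
        rw [tower_map_succ]
        exact E.isIso_map_η F hF _
      rw [show homOfLE (Nat.zero_le (n + 1)) = homOfLE (Nat.zero_le n) ≫
        homOfLE (Nat.le_add_right n 1) from rfl, Functor.map_comp]
      infer_instance
  have h : (E.tower M ⋙ F).IsEventuallyConstantFrom 0 := fun n f ↦ hG n
  exact h.isIso_ι_of_isColimit hc

variable {E} in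
/-- Mapping into a local object inverts the maps `toRefl`. -/
lemma IsLocal.bijective_toRefl {Z : C} (hZ : E.IsLocal Z) (M : C) :
    Function.Bijective (fun a : E.refl M ⟶ Z ↦ E.toRefl M ≫ a) := by
  have : PreservesColimitsOfShape ℕ (yoneda.obj Z).rightOp := by
    have : PreservesLimitsOfShape ℕᵒᵖ (yoneda.obj Z) := inferInstance
    exact preservesColimitsOfShape_rightOp _ _
  have := E.isIso_map_toRefl (yoneda.obj Z).rightOp (fun X ↦ by
    have : IsIso ((yoneda.obj Z).map (E.ε X).op) :=
      (isIso_iff_bijective _).2 (hZ.bijective X)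
    exact inferInstanceAs (IsIso ((yoneda.obj Z).map (E.ε X).op).op)) M
  have : IsIso ((yoneda.obj Z).map (E.toRefl M).op) := by
    rw [← isIso_op_iff]; exact this
  exact (isIso_iff_bijective _).1 this

end WellCopointed

end WellCopointed

/-! ### Morphisms which are locally bijective -/

section LocallyBijective

namespace WellCopointed

variable {C : Type u} [Category.{v} C] (E : WellCopointed C)

/-- The morphisms `Y ⟶ X` which are iterates of the copoint `ε`. A condition is thought of as
holding locally on `X` if it holds after composition with one of these morphisms. -/
inductive Cover : ∀ {Y X : C}, (Y ⟶ X) → Prop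
  | id (X : C) : Cover (𝟙 X)
  | ε_comp {Y X : C} (c : Y ⟶ X) (hc : Cover c) : Cover (E.ε Y ≫ c)

variable {E}

namespace Cover

lemma ε (X : C) : E.Cover (E.ε X) := by
  simpa using Cover.ε_comp _ (Cover.id (E := E) X)

lemma comp {Z Y X : C} {d : Z ⟶ Y} {c : Y ⟶ X} (hd : E.Cover d) (hc : E.Cover c) :
    E.Cover (d ≫ c) := by
  induction hd with
  | id => simpa
  | ε_comp d _ ih => simpa using Cover.ε_comp _ (ih hc)

lemma isFinitelyPresentable {Y X : C} {c : Y ⟶ X} (hc : E.Cover c)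
    (hX : IsFinitelyPresentable.{v} X) : IsFinitelyPresentable.{v} Y := by
  induction hc with
  | id => exact hX
  | ε_comp c _ ih => exact E.isFinitelyPresentable_obj _ (ih hX)

/-- Covers may be pulled back. -/
lemma exists_comp_eq {Y X X' : C} {c : Y ⟶ X} (hc : E.Cover c) (f : X' ⟶ X) :
    ∃ (Y' : C) (c' : Y' ⟶ X') (f' : Y' ⟶ Y), E.Cover c' ∧ c' ≫ f = f' ≫ c := by
  induction hc with
  | id => exact ⟨X', 𝟙 _, f, .id _, by simp⟩
  | ε_comp c _ ih =>
    obtain ⟨Y', c', f', hc', h⟩ := ih f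
    exact ⟨_, E.ε Y' ≫ c', E.S.map f', .ε_comp _ hc', by
      rw [Category.assoc, h, ← Category.assoc, ← Category.assoc, E.ε_naturality]⟩

/-- Two covers of the same object have a common refinement. -/
lemma exists_refinement {Y Y' X : C} {c : Y ⟶ X} {c' : Y' ⟶ X} (hc : E.Cover c)
    (hc' : E.Cover c') :
    ∃ (Z : C) (a : Z ⟶ Y) (b : Z ⟶ Y'), E.Cover (a ≫ c) ∧ a ≫ c = b ≫ c' := by
  obtain ⟨Z, a, b, ha, h⟩ := hc'.exists_comp_eq c
  exact ⟨Z, a, b, ha.comp hc, h⟩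

lemma bijective {Y X : C} {c : Y ⟶ X} (hc : E.Cover c) {Z : C} (hZ : E.IsLocal Z) :
    Function.Bijective (fun a : X ⟶ Z ↦ c ≫ a) := by
  induction hc with
  | id => simpa using! Function.bijective_id
  | ε_comp c _ ih =>
    have : (fun a ↦ (E.ε _ ≫ c) ≫ a) = (fun a ↦ E.ε _ ≫ a) ∘ fun a : _ ⟶ Z ↦ c ≫ a := by
      ext; simp
    rw [this]
    exact (hZ.bijective _).comp ih

end Cover

variable (E) in
/-- A morphism `φ : M ⟶ N` is locally bijective if, for finitely presentable `X`, two morphisms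
`X ⟶ M` with the same image in `N` agree locally on `X`, and every morphism `X ⟶ N` lifts to `M`
locally on `X`. -/
def LocallyBijective : MorphismProperty C := fun M N φ ↦
  ∀ (X : C) (_ : IsFinitelyPresentable.{v} X),
    (∀ a b : X ⟶ M, a ≫ φ = b ≫ φ → ∃ (Y : C) (c : Y ⟶ X), E.Cover c ∧ c ≫ a = c ≫ b) ∧
    ∀ b : X ⟶ N, ∃ (Y : C) (c : Y ⟶ X) (a : Y ⟶ M), E.Cover c ∧ a ≫ φ = c ≫ b

lemma locallyBijective_of_isIso {M N : C} (φ : M ⟶ N) [IsIso φ] : E.LocallyBijective φ :=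
  fun X _ ↦ ⟨fun a b h ↦ ⟨X, 𝟙 X, .id X, by rw [(cancel_mono φ).1 h]⟩,
    fun b ↦ ⟨X, 𝟙 X, b ≫ inv φ, .id X, by simp⟩⟩

instance : E.LocallyBijective.IsMultiplicative where
  id_mem X := locallyBijective_of_isIso _
  comp_mem φ ψ hφ hψ X hX := by
    refine ⟨fun a b h ↦ ?_, fun b ↦ ?_⟩
    · obtain ⟨Y, c, hc, h₁⟩ := (hψ X hX).1 (a ≫ φ) (b ≫ φ) (by simpa using h)
      obtain ⟨Z, d, hd, h₂⟩ := (hφ Y (hc.isFinitelyPresentable hX)).1 (c ≫ a) (c ≫ b)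
        (by simpa using h₁)
      exact ⟨Z, d ≫ c, hd.comp hc, by simpa using h₂⟩
    · obtain ⟨Y, c, a, hc, h₁⟩ := (hψ X hX).2 b
      obtain ⟨Z, d, a', hd, h₂⟩ := (hφ Y (hc.isFinitelyPresentable hX)).2 a
      exact ⟨Z, d ≫ c, a', hd.comp hc, by simp [reassoc_of% h₂, h₁]⟩

instance : E.LocallyBijective.HasTwoOutOfThreeProperty where
  of_postcomp {M N P} φ ψ hψ h X hX := by
    refine ⟨fun a b hab ↦ (h X hX).1 a b (by simp [reassoc_of% hab]), fun b ↦ ?_⟩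
    obtain ⟨Y, c, a, hc, h₁⟩ := (h X hX).2 (b ≫ ψ)
    obtain ⟨Z, d, hd, h₂⟩ := (hψ Y (hc.isFinitelyPresentable hX)).1 (a ≫ φ) (c ≫ b)
      (by simpa using h₁)
    exact ⟨Z, d ≫ c, d ≫ a, hd.comp hc, by simpa using h₂⟩
  of_precomp {M N P} φ ψ hφ h X hX := by
    refine ⟨fun a b hab ↦ ?_, fun b ↦ ?_⟩
    · obtain ⟨Y, c, a', hc, h₁⟩ := (hφ X hX).2 a
      obtain ⟨Y', c', b', hc', h₁'⟩ := (hφ X hX).2 b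
      obtain ⟨Z, d, d', hd, hdd'⟩ := hc.exists_refinement hc'
      obtain ⟨Z', e, he, h₂⟩ := (h Z (hd.isFinitelyPresentable hX)).1 (d ≫ a') (d' ≫ b') (by
        simp only [Category.assoc, reassoc_of% h₁, reassoc_of% h₁', hab]
        rw [reassoc_of% hdd'])
      refine ⟨Z', e ≫ d ≫ c, he.comp hd, ?_⟩
      have := congr($h₂ ≫ φ)
      simp only [Category.assoc, h₁, h₁'] at this ⊢
      rw [this, reassoc_of% hdd']
    · obtain ⟨Y, c, a, hc, h₁⟩ := (h X hX).2 b
      exact ⟨Y, c, a ≫ φ, hc, by simpa using h₁⟩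

instance : E.LocallyBijective.IsStableUnderBaseChange where
  of_isPullback {P Q P' R f g f' g'} sq h X hX := by
    refine ⟨fun a b hab ↦ ?_, fun b ↦ ?_⟩
    · obtain ⟨Y, c, hc, h₁⟩ := (h X hX).1 (a ≫ f') (b ≫ f') (by
        simp only [Category.assoc, sq.w]
        rw [reassoc_of% hab])
      exact ⟨Y, c, hc, sq.hom_ext (by simpa using h₁) (by simp [hab])⟩
    · obtain ⟨Y, c, a, hc, h₁⟩ := (h X hX).2 (b ≫ f)
      exact ⟨Y, c, sq.lift a (c ≫ b) (by simpa using h₁), hc, by simp⟩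

/-- The morphism `S X ⟶ M` adjoint to `b : X ⟶ T M` lifts the composition of `b` with `ε_X`. -/
lemma locallyBijective_η (M : C) : E.LocallyBijective (E.η M) := by
  refine fun X hX ↦ ⟨fun a b h ↦ ⟨_, _, .ε X, ?_⟩, fun b ↦
    ⟨_, _, (E.adj.homEquiv _ _).symm b, .ε X, ?_⟩⟩
  · apply (E.adj.homEquiv _ _).injective
    rw [homEquiv_ε_comp, homEquiv_ε_comp, h]
  · rw [← homEquiv_ε_comp, ← E.map_ε, E.adj.homEquiv_naturality_left, Equiv.apply_symm_apply]

variable (E) in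
lemma locallyBijective_tower_map (M : C) (n : ℕ) :
    E.LocallyBijective ((E.tower M).map (homOfLE (Nat.zero_le n))) := by
  induction n with
  | zero => exact E.LocallyBijective.id_mem _
  | succ n ih =>
    rw [show homOfLE (Nat.zero_le (n + 1)) = homOfLE (Nat.zero_le n) ≫
      homOfLE (Nat.le_add_right n 1) from rfl, Functor.map_comp, tower_map_succ]
    exact E.LocallyBijective.comp_mem _ _ ih (locallyBijective_η _)

/-- A condition which holds on `Y` if it holds on `S₁ Y` and on `S₂ Y` descends along every pair of
iterates of the two copoints. -/
lemma sieve_of_cover {E₁ E₂ : WellCopointed C} {X : C} (K : Sieve X)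
    (hK : ∀ ⦃Y : C⦄ (f : Y ⟶ X), K (E₁.ε Y ≫ f) → K (E₂.ε Y ≫ f) → K f)
    {Y₁ Y₂ : C} {c₁ : Y₁ ⟶ X} {c₂ : Y₂ ⟶ X} (hc₁ : E₁.Cover c₁) (hc₂ : E₂.Cover c₂)
    (h₁ : K c₁) (h₂ : K c₂) : K (𝟙 X) := by
  have key : ∀ {Y₂ Y : C} {c₂ : Y₂ ⟶ Y} (_ : E₂.Cover c₂) (f : Y ⟶ X),
      K (E₁.ε Y ≫ f) → K (c₂ ≫ f) → K f := by
    intro Y₂ Y c₂ hc₂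
    induction hc₂ with
    | id => intro f _ h; simpa using h
    | ε_comp c _ ih =>
      intro f h₁ h₂
      refine ih f h₁ (hK _ ?_ (by simpa using h₂))
      rw [← Category.assoc, ← E₁.ε_naturality, Category.assoc]
      exact K.downward_closed h₁ _
  have key' : ∀ {Y₁ Y : C} {c₁ : Y₁ ⟶ Y} (_ : E₁.Cover c₁) (f : Y ⟶ X)
      {Y₂ : C} {c₂ : Y₂ ⟶ Y} (_ : E₂.Cover c₂), K (c₁ ≫ f) → K (c₂ ≫ f) → K f := by
    intro Y₁ Y c₁ hc₁
    induction hc₁ with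
    | id => intro f _ _ _ h _; simpa using h
    | ε_comp c _ ih =>
      intro f Y₂ c₂ hc₂ h₁ h₂
      refine ih f hc₂ ?_ h₂
      obtain ⟨Y', c', f', hc', h⟩ := hc₂.exists_comp_eq c
      refine key hc' _ (by simpa using h₁) ?_
      rw [← Category.assoc, h, Category.assoc]
      exact K.downward_closed h₂ _
  exact key' hc₁ (𝟙 X) hc₂ (by simpa using h₁) (by simpa using h₂)

variable [IsLocallyFinitelyPresentable.{v} C]

/-- Between local objects, locally bijective morphisms are isomorphisms. -/
lemma LocallyBijective.isIso {M N : C} {φ : M ⟶ N} (h : E.LocallyBijective φ)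
    (hM : E.IsLocal M) (hN : E.IsLocal N) : IsIso φ := by
  refine isIso_of_isFinitelyPresentable_bijective φ fun X hX ↦ ⟨fun a b hab ↦ ?_, fun b ↦ ?_⟩
  · obtain ⟨Y, c, hc, h₁⟩ := (h X hX).1 a b hab
    exact (hc.bijective hM).1 h₁
  · obtain ⟨Y, c, a, hc, h₁⟩ := (h X hX).2 b
    obtain ⟨a, rfl⟩ := (hc.bijective hM).2 a
    exact ⟨a, (hc.bijective hN).1 (by simpa using h₁)⟩

variable (E) in
lemma locallyBijective_toRefl (M : C) : E.LocallyBijective (E.toRefl M) := by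
  have hc := colimit.isColimit (E.tower M)
  refine fun X hX ↦ ⟨fun a b h ↦ ?_, fun b ↦ ?_⟩
  · obtain ⟨n, hn, h₁⟩ := exists_eq_of_isColimit_nat hc (n := 0) a b h
    exact (E.locallyBijective_tower_map M n X hX).1 a b h₁
  · obtain ⟨n, b, rfl⟩ := exists_hom_of_isColimit_nat hc b
    obtain ⟨Y, c, a, hc', h₁⟩ := (E.locallyBijective_tower_map M n X hX).2 b
    refine ⟨Y, c, a, hc', ?_⟩
    have := h₁ =≫ colimit.ι (E.tower M) n
    rw [Category.assoc, colimit.w, Category.assoc] at this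
    exact this

/-- Two well-copointed endofunctors cover `C` if every object is the pushout of its two images. -/
def IsCover (E₁ E₂ : WellCopointed C) : Prop :=
  ∀ X : C, IsPushout (E₁.ε (E₂.S.obj X)) (E₁.S.map (E₂.ε X)) (E₂.ε X) (E₁.ε X)

section Cover

variable {E₁ E₂ : WellCopointed C}

/-- If `E₁` and `E₂` cover, then a morphism which is locally bijective for both is an
isomorphism. -/
lemma IsCover.isIso (h : IsCover E₁ E₂) {M N : C} {φ : M ⟶ N} (h₁ : E₁.LocallyBijective φ)
    (h₂ : E₂.LocallyBijective φ) : IsIso φ := by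
  have hinj : Mono φ := by
    refine ⟨fun {X} a b hab ↦ hom_ext_of_isFinitelyPresentable fun G hG i ↦ ?_⟩
    obtain ⟨Y₁, c₁, hc₁, e₁⟩ := (h₁ G hG).1 (i ≫ a) (i ≫ b) (by simp [hab])
    obtain ⟨Y₂, c₂, hc₂, e₂⟩ := (h₂ G hG).1 (i ≫ a) (i ≫ b) (by simp [hab])
    let K : Sieve G :=
      { arrows := fun Y f ↦ f ≫ i ≫ a = f ≫ i ≫ b
        downward_closed := fun {Y Z f} hf g ↦ by simp only [Category.assoc, hf] }
    -- Morphisms out of `Y` which agree on `S₁ Y` and `S₂ Y` agree, by the pushout property.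
    simpa [K] using sieve_of_cover K (fun Y f k₁ k₂ ↦ (h Y).hom_ext
      (by simpa [K] using k₂) (by simpa [K] using k₁)) hc₁ hc₂ e₁ e₂
  refine isIso_of_isFinitelyPresentable_bijective φ fun G hG ↦
    ⟨fun a b hab ↦ (cancel_mono φ).1 hab, fun b ↦ ?_⟩
  obtain ⟨Y₁, c₁, a₁, hc₁, e₁⟩ := (h₁ G hG).2 b
  obtain ⟨Y₂, c₂, a₂, hc₂, e₂⟩ := (h₂ G hG).2 b
  let K : Sieve G :=
    { arrows := fun Y f ↦ ∃ a : Y ⟶ M, a ≫ φ = f ≫ b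
      downward_closed := by
        rintro Y Z f ⟨a, ha⟩ g
        exact ⟨g ≫ a, by simp [ha]⟩ }
  -- Lifts over `S₁ Y` and `S₂ Y` agree on `S₁ (S₂ Y)`, because `φ` is a monomorphism, and hence
  -- glue.
  have := sieve_of_cover K (fun Y f ↦ by
    rintro ⟨k₁, hk₁⟩ ⟨k₂, hk₂⟩
    refine ⟨(h Y).desc k₂ k₁ ?_, ?_⟩
    · rw [← cancel_mono φ]
      simp only [Category.assoc, hk₁, hk₂]
      simpa using (h Y).w =≫ (f ≫ b)
    · apply (h Y).hom_ext <;> simp [hk₁, hk₂]) hc₁ hc₂ ⟨a₁, e₁⟩ ⟨a₂, e₂⟩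
  obtain ⟨a, ha⟩ := this
  exact ⟨a, by simpa using ha⟩

end Cover

/-- `E₁.S` commutes with `E₂.S` and the copoint of the latter. -/
def Commutes (E₁ E₂ : WellCopointed C) : Prop :=
  ∀ X : C, ∃ c : E₁.S.obj (E₂.S.obj X) ≅ E₂.S.obj (E₁.S.obj X),
    E₁.S.map (E₂.ε X) = c.hom ≫ E₂.ε (E₁.S.obj X)

section Commutes

variable {E₁ E₂ : WellCopointed C}

/-- By adjunction, orthogonality of `T₁ Z` to `ε₂` is orthogonality of `Z` to `S₁ ε₂`. -/
lemma Commutes.isLocal_T_obj (h : Commutes E₁ E₂) {Z : C} (hZ : E₂.IsLocal Z) :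
    E₂.IsLocal (E₁.T.obj Z) := by
  refine isLocal_of_bijective fun X _ ↦ ?_
  obtain ⟨c, hc⟩ := h X
  have : (fun a : X ⟶ E₁.T.obj Z ↦ E₂.ε X ≫ a) = (E₁.adj.homEquiv _ _ : _ → _) ∘
      (fun a ↦ c.hom ≫ a) ∘ (fun a : E₁.S.obj X ⟶ Z ↦ E₂.ε _ ≫ a) ∘
      (E₁.adj.homEquiv _ _).symm := by
    ext a
    apply (E₁.adj.homEquiv _ _).symm.injective
    simp [E₁.adj.homEquiv_naturality_left_symm, hc]
  rw [this]
  exact (E₁.adj.homEquiv _ _).bijective.comp ((c.symm.homFromEquiv (Z := Z)).bijective.comp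
    ((hZ.bijective _).comp (E₁.adj.homEquiv _ _).symm.bijective))

/-- If `E₁` and `E₂` commute, then reflecting with respect to `E₁` preserves `E₂`-local objects. -/
lemma Commutes.isLocal_refl (h : Commutes E₁ E₂) {Z : C} (hZ : E₂.IsLocal Z) :
    E₂.IsLocal (E₁.refl Z) := by
  have hn (n : ℕ) : E₂.IsLocal ((E₁.tower Z).obj n) := by
    induction n with
    | zero => exact hZ
    | succ n ih => exact h.isLocal_T_obj ih
  refine E₂.isLocal_of_isColimit (colimit.isColimit (E₁.tower Z)) fun n ↦ ?_
  have : IsIso (E₂.η ((E₁.tower Z).obj n)) := hn n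
  exact ⟨n, le_rfl, inv (E₂.η _), by
    rw [IsIso.hom_inv_id]; exact ((E₁.tower Z).map_id n).symm, by
    rw [IsIso.inv_hom_id]
    erw [(E₁.tower Z).map_id n, E₂.T.map_id]⟩

end Commutes

end WellCopointed

end LocallyBijective

/-! ### Reflectors onto local objects and the gluing of objects -/

section RestrictionMap

universe v₀ v₁ v₂ u₀ u₁ u₂

variable {C : Type u₀} [Category.{v₀} C] {D : Type u₁} [Category.{v₁} D]
  {D' : Type u₂} [Category.{v₂} D'] {R : C ⥤ D} {R' : C ⥤ D'} {Q : D ⥤ D'} (i : R ⋙ Q ≅ R')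
  {ι : D ⥤ C} {ι' : D' ⥤ C} (adj : R ⊣ ι) (adj' : R' ⊣ ι')

lemma homEquiv_comp_restrictionMap {M : C} {A : D} (a : R.obj M ⟶ A) :
    adj.homEquiv M A a ≫ restrictionMap i adj adj' A =
      adj'.homEquiv M (Q.obj A) (i.inv.app M ≫ Q.map a) := by
  have := i.inv.naturality (adj.homEquiv M A a)
  rw [restrictionMap, ← adj'.homEquiv_naturality_left, reassoc_of% this]
  dsimp
  rw [← Q.map_comp, ← adj.homEquiv_counit, Equiv.symm_apply_apply]

lemma restrictionMap_naturality {A A' : D} (a : A ⟶ A') :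
    ι.map a ≫ restrictionMap i adj adj' A' =
      restrictionMap i adj adj' A ≫ ι'.map (Q.map a) := by
  have h : ι.map a = adj.homEquiv _ _ (adj.counit.app A ≫ a) := by
    simp [Adjunction.homEquiv_unit]
  rw [h, homEquiv_comp_restrictionMap, restrictionMap, ← adj'.homEquiv_naturality_right]
  simp

lemma unit_comp_restrictionMap (M : C) :
    adj.unit.app M ≫ restrictionMap i adj adj' (R.obj M) ≫ ι'.map (i.hom.app M) =
      adj'.unit.app M := by
  have := homEquiv_comp_restrictionMap i adj adj' (𝟙 (R.obj M))
  rw [adj.homEquiv_id] at this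
  rw [reassoc_of% this, ← adj'.homEquiv_naturality_right]
  simp [adj'.homEquiv_id]

lemma isIso_map_restrictionMap [ι.Full] [ι.Faithful] [ι'.Full] [ι'.Faithful] (A : D) :
    IsIso (R'.map (restrictionMap i adj adj' A)) := by
  have h : R'.map (restrictionMap i adj adj' A) ≫ adj'.counit.app _ =
      i.inv.app (ι.obj A) ≫ Q.map (adj.counit.app A) := by
    exact (adj'.homEquiv_counit _ _ _).symm.trans (Equiv.symm_apply_apply _ _)
  exact IsIso.of_isIso_fac_right h

end RestrictionMap

namespace WellCopointed

universe v₁ v₂ v₃ u₁ u₂ u₃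

variable {C : Type u} [Category.{v} C] {E : WellCopointed C}

lemma IsLocal.of_iso {Z Z' : C} (hZ : E.IsLocal Z) (i : Z ≅ Z') : E.IsLocal Z' := by
  have : IsIso (E.η Z) := hZ
  have h : E.η Z' = i.inv ≫ E.η Z ≫ E.T.map i.hom := by
    rw [← E.η_naturality, i.inv_hom_id_assoc]
  change IsIso (E.η Z')
  rw [h]
  infer_instance

/-- `R` is a reflector onto the local objects, up to an equivalence of its codomain with the
category of local objects. -/
structure IsReflector (E : WellCopointed C) {D : Type u₁} [Category.{v₁} D] (R : C ⥤ D) : Prop where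
  isIso_map_ε (X : C) : IsIso (R.map (E.ε X))
  exists_rightAdjoint : ∃ (ι : D ⥤ C) (_ : R ⊣ ι),
    ι.Full ∧ ι.Faithful ∧ ∀ Z, E.IsLocal Z → ι.essImage Z

/-- Right adjoints of functors which invert all `ε_X` take values in local objects. -/
lemma isLocal_rightAdjoint_obj [IsLocallyFinitelyPresentable.{v} C] {D : Type u₁}
    [Category.{v₁} D] {R : C ⥤ D} {ι : D ⥤ C} (adj : R ⊣ ι) (hR : ∀ X, IsIso (R.map (E.ε X)))
    (A : D) : E.IsLocal (ι.obj A) := by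
  refine isLocal_of_bijective fun X _ ↦ ?_
  have := hR X
  have h : (fun a : X ⟶ ι.obj A ↦ E.ε X ≫ a) = (adj.homEquiv _ _ : _ → _) ∘
      (fun a ↦ R.map (E.ε X) ≫ a) ∘ (adj.homEquiv _ _).symm := by
    ext a
    apply (adj.homEquiv _ _).symm.injective
    simp [adj.homEquiv_naturality_left_symm]
  rw [h]
  exact (adj.homEquiv _ _).bijective.comp
    (((asIso (R.map (E.ε X))).symm.homFromEquiv (Z := A)).bijective.comp
      (adj.homEquiv _ _).symm.bijective)

namespace IsReflector

section

variable {D : Type u₁} [Category.{v₁} D] {R : C ⥤ D} (hR : E.IsReflector R)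
  {ι : D ⥤ C} (adj : R ⊣ ι)

include hR adj

lemma full : ι.Full := by
  obtain ⟨ι', adj', _, _, _⟩ := hR.exists_rightAdjoint
  exact Functor.Full.of_iso (adj'.rightAdjointUniq adj)

lemma faithful : ι.Faithful := by
  obtain ⟨ι', adj', _, _, _⟩ := hR.exists_rightAdjoint
  exact Functor.Faithful.of_iso (adj'.rightAdjointUniq adj)

lemma isIso_unit_app {Z : C} (hZ : E.IsLocal Z) : IsIso (adj.unit.app Z) := by
  obtain ⟨ι', adj', _, _, h⟩ := hR.exists_rightAdjoint
  have := hR.full adj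
  have := hR.faithful adj
  obtain ⟨A, ⟨e⟩⟩ := h Z hZ
  rw [adj.isIso_unit_app_iff_mem_essImage]
  exact ⟨A, ⟨(adj.rightAdjointUniq adj').app A ≪≫ e⟩⟩

variable [IsLocallyFinitelyPresentable.{v} C]

lemma isLocal_obj (A : D) : E.IsLocal (ι.obj A) := isLocal_rightAdjoint_obj adj hR.isIso_map_ε A

lemma isIso_map_toRefl (M : C) : IsIso (R.map (E.toRefl M)) := by
  have : PreservesColimitsOfSize.{0, 0} R := adj.leftAdjoint_preservesColimits
  exact E.isIso_map_toRefl R hR.isIso_map_ε M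

lemma nonempty_obj_iso_refl (M : C) : Nonempty (ι.obj (R.obj M) ≅ E.refl M) := by
  have := hR.isIso_unit_app adj (E.isLocal_refl M)
  have := hR.isIso_map_toRefl adj M
  exact ⟨ι.mapIso (asIso (R.map (E.toRefl M))) ≪≫ (asIso (adj.unit.app (E.refl M))).symm⟩

lemma locallyBijective_unit_app (M : C) : E.LocallyBijective (adj.unit.app M) := by
  have := hR.isIso_unit_app adj (E.isLocal_refl M)
  have := hR.isIso_map_toRefl adj M
  have h : adj.unit.app M ≫ ι.map (R.map (E.toRefl M)) =
      E.toRefl M ≫ adj.unit.app (E.refl M) := (adj.unit.naturality _).symm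
  refine E.LocallyBijective.of_postcomp (W' := E.LocallyBijective) _
    (ι.map (R.map (E.toRefl M))) (locallyBijective_of_isIso _) ?_
  rw [h]
  exact E.LocallyBijective.comp_mem _ _ (E.locallyBijective_toRefl M) (locallyBijective_of_isIso _)

end

/-- A reflector inverts exactly the locally bijective morphisms. -/
lemma isIso_map_iff [IsLocallyFinitelyPresentable.{v} C] {D : Type u₁} [Category.{v₁} D]
    {R : C ⥤ D} (hR : E.IsReflector R) {M N : C} (φ : M ⟶ N) :
    IsIso (R.map φ) ↔ E.LocallyBijective φ := by
  obtain ⟨ι, adj, _, _, h⟩ := hR.exists_rightAdjoint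
  have h₁ := hR.locallyBijective_unit_app adj
  have hn : φ ≫ adj.unit.app N = adj.unit.app M ≫ ι.map (R.map φ) := adj.unit.naturality φ
  constructor
  · intro hφ
    refine E.LocallyBijective.of_postcomp _ _ (h₁ N) ?_
    rw [hn]
    exact E.LocallyBijective.comp_mem _ _ (h₁ M) (locallyBijective_of_isIso _)
  · intro hφ
    have h₂ : E.LocallyBijective (ι.map (R.map φ)) := by
      refine E.LocallyBijective.of_precomp _ _ (h₁ M) ?_
      rw [← hn]
      exact E.LocallyBijective.comp_mem _ _ hφ (h₁ N)
    have := h₂.isIso (hR.isLocal_obj adj _) (hR.isLocal_obj adj _)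
    exact isIso_of_reflects_iso (R.map φ) ι

end IsReflector

lemma IsReflector.of_equivalence {D : Type u₁} [Category.{v₁} D] {D' : Type u₂} [Category.{v₂} D']
    {R : C ⥤ D} (hR : E.IsReflector R) {R' : C ⥤ D'} (G : D ⥤ D') [G.IsEquivalence]
    (i : R ⋙ G ≅ R') : E.IsReflector R' where
  isIso_map_ε X := by
    have := hR.isIso_map_ε X
    rw [← NatIso.isIso_map_iff i]
    dsimp
    infer_instance
  exists_rightAdjoint := by
    obtain ⟨ι, adj, _, _, h⟩ := hR.exists_rightAdjoint
    refine ⟨G.inv ⋙ ι, (adj.comp G.asEquivalence.toAdjunction).ofNatIsoLeft i, inferInstance,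
      inferInstance, fun Z hZ ↦ ?_⟩
    obtain ⟨A, ⟨e⟩⟩ := h Z hZ
    exact ⟨G.obj A, ⟨ι.mapIso (G.asEquivalence.unitIso.symm.app A) ≪≫ e⟩⟩

section Gluing

variable {E₁ E₂ E₁₂ : WellCopointed C}
  {C₁ : Type u₁} [Category.{v₁} C₁] {C₂ : Type u₂} [Category.{v₂} C₂]
  {C₁₂ : Type u₃} [Category.{v₃} C₁₂]
  {R₁ : C ⥤ C₁} {R₂ : C ⥤ C₂} {R₁₂ : C ⥤ C₁₂} {Q₁ : C₁ ⥤ C₁₂} {Q₂ : C₂ ⥤ C₁₂}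

lemma isIso_map_ε_of_comp (h₁ : E₁.IsReflector R₁) (i₁ : R₁ ⋙ Q₁ ≅ R₁₂) (X : C) :
    IsIso (R₁₂.map (E₁.ε X)) := by
  have := h₁.isIso_map_ε X
  rw [← NatIso.isIso_map_iff i₁]
  dsimp
  infer_instance

/-- A pair of compatible morphisms in `C₁` and `C₂` is induced by a morphism in `C`. -/
lemma exists_toTriples_map_eq (i₁ : R₁ ⋙ Q₁ ≅ R₁₂) (i₂ : R₂ ⋙ Q₂ ≅ R₁₂) {ι₁ : C₁ ⥤ C}
    {ι₂ : C₂ ⥤ C} {ι₁₂ : C₁₂ ⥤ C} (adj₁ : R₁ ⊣ ι₁) (adj₂ : R₂ ⊣ ι₂) (adj₁₂ : R₁₂ ⊣ ι₁₂) {M N : C}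
    (sq : IsPullback (adj₁.unit.app N) (adj₂.unit.app N)
      (restrictionMap i₁ adj₁ adj₁₂ (R₁.obj N) ≫ ι₁₂.map (i₁.hom.app N))
      (restrictionMap i₂ adj₂ adj₁₂ (R₂.obj N) ≫ ι₁₂.map (i₂.hom.app N)))
    (f₁ : R₁.obj M ⟶ R₁.obj N) (f₂ : R₂.obj M ⟶ R₂.obj N)
    (w : Q₁.map f₁ ≫ ((i₁ ≪≫ i₂.symm).app N).hom = ((i₁ ≪≫ i₂.symm).app M).hom ≫ Q₂.map f₂) :
    ∃ f : M ⟶ N, (toTriples (i₁ ≪≫ i₂.symm)).map f = ⟨f₁, f₂, w⟩ := by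
  have hw : Q₁.map f₁ ≫ i₁.hom.app N =
      i₁.hom.app M ≫ i₂.inv.app M ≫ Q₂.map f₂ ≫ i₂.hom.app N := by
    simpa using w =≫ i₂.hom.app N
  have h : (adj₁.unit.app M ≫ ι₁.map f₁) ≫
        restrictionMap i₁ adj₁ adj₁₂ (R₁.obj N) ≫ ι₁₂.map (i₁.hom.app N) =
      (adj₂.unit.app M ≫ ι₂.map f₂) ≫
        restrictionMap i₂ adj₂ adj₁₂ (R₂.obj N) ≫ ι₁₂.map (i₂.hom.app N) := by
    have h₁ := restrictionMap_naturality i₁ adj₁ adj₁₂ f₁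
    have h₂ := restrictionMap_naturality i₂ adj₂ adj₁₂ f₂
    rw [Category.assoc, reassoc_of% h₁, Category.assoc, reassoc_of% h₂, ← ι₁₂.map_comp, hw,
      ι₁₂.map_comp, reassoc_of% (unit_comp_restrictionMap i₁ adj₁ adj₁₂ M),
      ← reassoc_of% (unit_comp_restrictionMap i₂ adj₂ adj₁₂ M)]
    simp only [← ι₁₂.map_comp, Iso.hom_inv_id_app_assoc]
  refine ⟨sq.lift _ _ h, CategoricalPullback.hom_ext ?_ ?_⟩
  · change R₁.map _ = f₁
    apply (adj₁.homEquiv _ _).injective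
    rw [adj₁.homEquiv_unit, adj₁.homEquiv_unit]
    exact (adj₁.unit.naturality _).symm.trans (sq.lift_fst _ _ h)
  · change R₂.map _ = f₂
    apply (adj₂.homEquiv _ _).injective
    rw [adj₂.homEquiv_unit, adj₂.homEquiv_unit]
    exact (adj₂.unit.naturality _).symm.trans (sq.lift_snd _ _ h)

/-- The transposes of the projections of a fiber product are compatible in `C₁₂`. -/
lemma map_comp_eq_of_commSq (i₁ : R₁ ⋙ Q₁ ≅ R₁₂) (i₂ : R₂ ⋙ Q₂ ≅ R₁₂) {ι₁ : C₁ ⥤ C}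
    {ι₂ : C₂ ⥤ C} {ι₁₂ : C₁₂ ⥤ C} (adj₁ : R₁ ⊣ ι₁) (adj₂ : R₂ ⊣ ι₂) (adj₁₂ : R₁₂ ⊣ ι₁₂)
    {A : C₁} {B : C₂} (τ : Q₁.obj A ⟶ Q₂.obj B) {P : C} {p : P ⟶ ι₁.obj A} {q : P ⟶ ι₂.obj B}
    (h : p ≫ restrictionMap i₁ adj₁ adj₁₂ A ≫ ι₁₂.map τ = q ≫ restrictionMap i₂ adj₂ adj₁₂ B) :
    Q₁.map ((adj₁.homEquiv P A).symm p) ≫ τ =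
      ((i₁ ≪≫ i₂.symm).app P).hom ≫ Q₂.map ((adj₂.homEquiv P B).symm q) := by
  obtain ⟨p, rfl⟩ := (adj₁.homEquiv P A).surjective p
  obtain ⟨q, rfl⟩ := (adj₂.homEquiv P B).surjective q
  rw [homEquiv_comp_restrictionMap, reassoc_of% (homEquiv_comp_restrictionMap i₁ adj₁ adj₁₂ p),
    ← adj₁₂.homEquiv_naturality_right, Equiv.apply_eq_iff_eq] at h
  simpa using i₁.hom.app P ≫= h

variable [IsLocallyFinitelyPresentable.{v} C]

/-- A morphism between `E₁`-local objects which becomes invertible in `C₁₂` already becomes so in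
`C₂`, because reflecting onto the `E₂`-local objects does not leave the `E₁`-local ones. -/
lemma locallyBijective_of_isIso_map (hc : Commutes E₂ E₁)
    (hl : ∀ Z, E₁.IsLocal Z → E₂.IsLocal Z → E₁₂.IsLocal Z)
    (h₂ : E₂.IsReflector R₂) (h₁₂ : E₁₂.IsReflector R₁₂) (i₂ : R₂ ⋙ Q₂ ≅ R₁₂)
    {N N' : C} (hN : E₁.IsLocal N) (hN' : E₁.IsLocal N') (φ : N ⟶ N') (hφ : IsIso (R₁₂.map φ)) :
    E₂.LocallyBijective φ := by
  obtain ⟨ι, adj, _, _, -⟩ := h₂.exists_rightAdjoint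
  have hloc {M : C} (hM : E₁.IsLocal M) : E₁₂.IsLocal (ι.obj (R₂.obj M)) := by
    obtain ⟨e⟩ := h₂.nonempty_obj_iso_refl adj M
    exact hl _ ((hc.isLocal_refl hM).of_iso e.symm) (h₂.isLocal_obj adj _)
  have hu (M : C) : IsIso (R₁₂.map (adj.unit.app M)) := by
    have := (h₂.isIso_map_iff _).2 (h₂.locallyBijective_unit_app adj M)
    rw [← NatIso.isIso_map_iff i₂]
    dsimp
    infer_instance
  have h : R₁₂.map φ ≫ R₁₂.map (adj.unit.app N') =
      R₁₂.map (adj.unit.app N) ≫ R₁₂.map (ι.map (R₂.map φ)) := by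
    rw [← R₁₂.map_comp, ← R₁₂.map_comp]
    exact congr_arg _ (adj.unit.naturality φ)
  have h' : IsIso (R₁₂.map (ι.map (R₂.map φ))) := IsIso.of_isIso_fac_left h.symm
  have := ((h₁₂.isIso_map_iff _).1 h').isIso (hloc hN) (hloc hN')
  rw [← h₂.isIso_map_iff]
  exact isIso_of_reflects_iso (R₂.map φ) ι

/-- The restriction map `A ⟶ A|₁₂` is a morphism between `E₁`-local objects which becomes invertible
in `C₁₂`. -/
lemma locallyBijective_restrictionMap (hc : Commutes E₂ E₁)
    (hl : ∀ Z, E₁.IsLocal Z → E₂.IsLocal Z → E₁₂.IsLocal Z)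
    (h₁ : E₁.IsReflector R₁) (h₂ : E₂.IsReflector R₂) (h₁₂ : E₁₂.IsReflector R₁₂)
    (i₁ : R₁ ⋙ Q₁ ≅ R₁₂) (i₂ : R₂ ⋙ Q₂ ≅ R₁₂) {ι₁ : C₁ ⥤ C} {ι₁₂ : C₁₂ ⥤ C}
    (adj₁ : R₁ ⊣ ι₁) (adj₁₂ : R₁₂ ⊣ ι₁₂) (A : C₁) :
    E₂.LocallyBijective (restrictionMap i₁ adj₁ adj₁₂ A) := by
  have := h₁.full adj₁
  have := h₁.faithful adj₁
  have := h₁₂.full adj₁₂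
  have := h₁₂.faithful adj₁₂
  exact locallyBijective_of_isIso_map hc hl h₂ h₁₂ i₂ (h₁.isLocal_obj adj₁ A)
    (isLocal_rightAdjoint_obj adj₁₂ (isIso_map_ε_of_comp h₁ i₁) _) _
    (isIso_map_restrictionMap i₁ adj₁ adj₁₂ A)

/-- A commutative square is a pullback if two of its parallel sides are locally bijective for `E₁`
and the other two for `E₂`. -/
lemma IsCover.isPullback (hcov : IsCover E₁ E₂) {P X Y Z : C} {p : P ⟶ X} {q : P ⟶ Y}
    {r : X ⟶ Z} {s : Y ⟶ Z} (w : p ≫ r = q ≫ s) (hp : E₁.LocallyBijective p)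
    (hq : E₂.LocallyBijective q) (hr : E₂.LocallyBijective r) (hs : E₁.LocallyBijective s) :
    IsPullback p q r s := by
  have := hasPullbacks_of_isLocallyFinitelyPresentable C
  let d := pullback.lift p q w
  have h₁ : E₁.LocallyBijective d := by
    refine E₁.LocallyBijective.of_postcomp d (pullback.fst r s)
      (E₁.LocallyBijective.of_isPullback (IsPullback.of_hasPullback r s).flip hs) ?_
    simpa only [d, pullback.lift_fst, pullback.lift_snd]
  have h₂ : E₂.LocallyBijective d := by
    refine E₂.LocallyBijective.of_postcomp d (pullback.snd r s)
      (E₂.LocallyBijective.of_isPullback (IsPullback.of_hasPullback r s) hr) ?_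
    simpa only [d, pullback.lift_fst, pullback.lift_snd]
  have := hcov.isIso h₁ h₂
  exact IsPullback.of_iso_pullback ⟨w⟩ (asIso d) (pullback.lift_fst _ _ _) (pullback.lift_snd _ _ _)

/-- Objects glue along a cover: the square of units at `M` and the fiber product squares of triples
have one pair of parallel sides locally bijective for `E₁` and the other one for `E₂`. -/
theorem gluesObjects (hcov : IsCover E₁ E₂) (hc : Commutes E₁ E₂) (hc' : Commutes E₂ E₁)
    (hl : ∀ Z, E₁.IsLocal Z → E₂.IsLocal Z → E₁₂.IsLocal Z)
    (h₁ : E₁.IsReflector R₁) (h₂ : E₂.IsReflector R₂) (h₁₂ : E₁₂.IsReflector R₁₂)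
    (i₁ : R₁ ⋙ Q₁ ≅ R₁₂) (i₂ : R₂ ⋙ Q₂ ≅ R₁₂) : GluesObjects i₁ i₂ := by
  have hl' : ∀ Z, E₂.IsLocal Z → E₁.IsLocal Z → E₁₂.IsLocal Z := fun Z a b ↦ hl Z b a
  have isPullback_unit {ι₁ : C₁ ⥤ C} {ι₂ : C₂ ⥤ C} {ι₁₂ : C₁₂ ⥤ C}
      (adj₁ : R₁ ⊣ ι₁) (adj₂ : R₂ ⊣ ι₂) (adj₁₂ : R₁₂ ⊣ ι₁₂) (M : C) :
      IsPullback (adj₁.unit.app M) (adj₂.unit.app M)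
        (restrictionMap i₁ adj₁ adj₁₂ (R₁.obj M) ≫ ι₁₂.map (i₁.hom.app M))
        (restrictionMap i₂ adj₂ adj₁₂ (R₂.obj M) ≫ ι₁₂.map (i₂.hom.app M)) := by
    refine hcov.isPullback ?_ (h₁.locallyBijective_unit_app adj₁ M)
      (h₂.locallyBijective_unit_app adj₂ M) ?_ ?_
    · rw [unit_comp_restrictionMap, unit_comp_restrictionMap]
    · exact E₂.LocallyBijective.comp_mem _ _
        (locallyBijective_restrictionMap hc' hl h₁ h₂ h₁₂ i₁ i₂ adj₁ adj₁₂ _)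
        (locallyBijective_of_isIso _)
    · exact E₁.LocallyBijective.comp_mem _ _
        (locallyBijective_restrictionMap hc hl' h₂ h₁ h₁₂ i₂ i₁ adj₂ adj₁₂ _)
        (locallyBijective_of_isIso _)
  have isIso_of_isPullback {ι₁ : C₁ ⥤ C} {ι₂ : C₂ ⥤ C} {ι₁₂ : C₁₂ ⥤ C}
      (adj₁ : R₁ ⊣ ι₁) (adj₂ : R₂ ⊣ ι₂) (adj₁₂ : R₁₂ ⊣ ι₁₂)
      (A : C₁) (B : C₂) (τ : Q₁.obj A ≅ Q₂.obj B) (P : C)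
      (p : P ⟶ ι₁.obj A) (q : P ⟶ ι₂.obj B)
      (sq : IsPullback p q (restrictionMap i₁ adj₁ adj₁₂ A ≫ ι₁₂.map τ.hom)
        (restrictionMap i₂ adj₂ adj₁₂ B)) :
      IsIso ((adj₁.homEquiv P A).symm p) ∧ IsIso ((adj₂.homEquiv P B).symm q) := by
    have := h₁.full adj₁
    have := h₁.faithful adj₁
    have := h₂.full adj₂
    have := h₂.faithful adj₂
    have hp : IsIso (R₁.map p) := (h₁.isIso_map_iff _).2
      (E₁.LocallyBijective.of_isPullback sq.flip
        (locallyBijective_restrictionMap hc hl' h₂ h₁ h₁₂ i₂ i₁ adj₂ adj₁₂ _))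
    have hq : IsIso (R₂.map q) := (h₂.isIso_map_iff _).2
      (E₂.LocallyBijective.of_isPullback sq (E₂.LocallyBijective.comp_mem _ _
        (locallyBijective_restrictionMap hc' hl h₁ h₂ h₁₂ i₁ i₂ adj₁ adj₁₂ _)
        (locallyBijective_of_isIso _)))
    rw [adj₁.homEquiv_counit, adj₂.homEquiv_counit]
    exact ⟨inferInstance, inferInstance⟩
  obtain ⟨ι₁, adj₁, hι₁⟩ := h₁.exists_rightAdjoint
  obtain ⟨ι₂, adj₂, hι₂⟩ := h₂.exists_rightAdjoint
  obtain ⟨ι₁₂, adj₁₂, hι₁₂⟩ := h₁₂.exists_rightAdjoint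
  refine
    { isEquivalence := ?_
      reflective₁ := ⟨ι₁, adj₁, hι₁.1, hι₁.2.1⟩
      reflective₂ := ⟨ι₂, adj₂, hι₂.1, hι₂.2.1⟩
      reflective₁₂ := ⟨ι₁₂, adj₁₂, hι₁₂.1, hι₁₂.2.1⟩
      isPullback_unit := isPullback_unit
      isIso_of_isPullback := isIso_of_isPullback }
  have hsq := isPullback_unit adj₁ adj₂ adj₁₂
  refine
    { faithful := ⟨fun {M N} f g hfg ↦ (hsq N).hom_ext ?_ ?_⟩
      full := ⟨fun {M N} f ↦ ?_⟩
      essSurj := ⟨fun T ↦ ?_⟩ }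
  · have : R₁.map f = R₁.map g := congr_arg CategoricalPullback.Hom.fst hfg
    simpa [this] using adj₁.unit.naturality f
  · have : R₂.map f = R₂.map g := congr_arg CategoricalPullback.Hom.snd hfg
    simpa [this] using adj₂.unit.naturality f
  · obtain ⟨f₁, f₂, w⟩ := f
    exact exists_toTriples_map_eq i₁ i₂ adj₁ adj₂ adj₁₂ (hsq N) f₁ f₂ w
  · have := hasPullbacks_of_isLocallyFinitelyPresentable C
    obtain ⟨A, B, τ⟩ := T
    have sq := IsPullback.of_hasPullback (restrictionMap i₁ adj₁ adj₁₂ A ≫ ι₁₂.map τ.hom)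
      (restrictionMap i₂ adj₂ adj₁₂ B)
    obtain ⟨hp, hq⟩ := isIso_of_isPullback adj₁ adj₂ adj₁₂ A B τ _ _ _ sq
    exact ⟨_, ⟨CategoricalPullback.mkIso (@asIso _ _ _ _ _ hp) (@asIso _ _ _ _ _ hq)
      (map_comp_eq_of_commSq i₁ i₂ adj₁ adj₂ adj₁₂ τ.hom sq.w)⟩⟩

end Gluing

end WellCopointed

/-! ### Idals as well-copointed endofunctors -/

section Idal

variable {C : Type u} [Category.{v} C] [MonoidalCategory C]

/-- The endofunctor `I ⊗ -` is well-copointed. -/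
lemma IsIdal.whiskerLeft_eq {I : C} {e : I ⟶ 𝟙_ C} (he : IsIdal e) (X : C) :
    I ◁ (e ▷ X ≫ (λ_ X).hom) = e ▷ (I ⊗ X) ≫ (λ_ (I ⊗ X)).hom := by
  have h := congr((α_ I I X).inv ≫ $he ▷ X)
  simp only [comp_whiskerRight, MonoidalCategory.whiskerLeft_comp] at h ⊢
  simpa using h.symm

lemma map_whiskerRight_comp_leftUnitor {D : Type*} [Category* D] [MonoidalCategory D]
    (F : C ⥤ D) [F.Monoidal] {I : C} (e : I ⟶ 𝟙_ C) (h : IsIso (F.map e)) (X : C) :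
    IsIso (F.map (e ▷ X ≫ (λ_ X).hom)) := by
  rw [F.map_comp, Functor.Monoidal.map_whiskerRight]
  infer_instance

/-- An idal which is a split epimorphism is an isomorphism. -/
lemma IsIdal.isIso_of_isSplitEpi {I : C} {e : I ⟶ 𝟙_ C} (he : IsIdal e) [IsSplitEpi e] :
    IsIso e := by
  refine ⟨section_ e, ?_, by simp⟩
  have h := congr((ρ_ I).inv ≫ I ◁ section_ e ≫ $he)
  have h₂ : I ◁ section_ e ≫ I ◁ e ≫ (ρ_ I).hom = (ρ_ I).hom := by
    rw [← MonoidalCategory.whiskerLeft_comp_assoc]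
    simp
  rw [h₂, Iso.inv_hom_id, whisker_exchange_assoc, leftUnitor_naturality,
    ← rightUnitor_inv_naturality_assoc, ← unitors_inv_equal, Iso.inv_hom_id_assoc] at h
  exact h

lemma IsIdal.map {D : Type*} [Category* D] [MonoidalCategory D] (F : C ⥤ D) [F.Monoidal]
    {I : C} {e : I ⟶ 𝟙_ C} (he : IsIdal e) : IsIdal (F.map e ≫ Functor.OplaxMonoidal.η F) := by
  have h := congr(Functor.LaxMonoidal.μ F I I ≫ F.map $he)
  rw [IsIdal]
  simp only [F.map_comp, Functor.Monoidal.map_whiskerRight, Functor.Monoidal.map_whiskerLeft,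
    Functor.Monoidal.map_leftUnitor, Functor.Monoidal.map_rightUnitor] at h
  simpa using h

lemma idalProd_eq_left {I J : C} (e : I ⟶ 𝟙_ C) (f : J ⟶ 𝟙_ C) :
    idalProd e f = (e ▷ J ≫ (λ_ J).hom) ≫ f := by
  simp [idalProd, MonoidalCategory.tensorHom_def]

lemma idalProd_eq_right {I J : C} (e : I ⟶ 𝟙_ C) (f : J ⟶ 𝟙_ C) :
    idalProd e f = (I ◁ f ≫ (ρ_ I).hom) ≫ e := by
  simp [idalProd, tensorHom_def', unitors_equal]

/-- If a product of idals is inverted by a tensor functor, then so are its factors: their images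
are idals which are split epimorphisms. -/
lemma isIso_map_of_isIso_map_idalProd {D : Type*} [Category* D] [MonoidalCategory D] (F : C ⥤ D)
    [F.Monoidal] {I J : C} {e : I ⟶ 𝟙_ C} {f : J ⟶ 𝟙_ C} (he : IsIdal e) (hf : IsIdal f)
    (h : IsIso (F.map (idalProd e f))) : IsIso (F.map e) ∧ IsIso (F.map f) := by
  have key {I : C} {e : I ⟶ 𝟙_ C} (he : IsIdal e) {K : C} (a : K ⟶ I)
      (h : IsIso (F.map (a ≫ e))) : IsIso (F.map e) := by
    rw [F.map_comp] at h
    have : IsSplitEpi (F.map e ≫ Functor.OplaxMonoidal.η F) :=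
      ⟨⟨Functor.LaxMonoidal.ε F ≫ inv (F.map a ≫ F.map e) ≫ F.map a, by
        have := IsIso.inv_hom_id_assoc (F.map a ≫ F.map e) (Functor.OplaxMonoidal.η F)
        simp only [Category.assoc] at this ⊢
        rw [this]
        simp⟩⟩
    have := (he.map F).isIso_of_isSplitEpi
    exact IsIso.of_isIso_comp_right (F.map e) (Functor.OplaxMonoidal.η F)
  exact ⟨key he _ (idalProd_eq_right e f ▸ h), key hf _ (idalProd_eq_left e f ▸ h)⟩

variable [SymmetricCategory C]

/-- Up to the interchange of the inner factors of `(I ⊗ J) ⊗ (I ⊗ J)`, the identity for `e ⊗ f` is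
the tensor product of those for `e` and `f`. -/
lemma isIdal_idalProd {I J : C} {e : I ⟶ 𝟙_ C} {f : J ⟶ 𝟙_ C} (he : IsIdal e) (hf : IsIdal f) :
    IsIdal (idalProd e f) := by
  have h₁ : idalProd e f ▷ (I ⊗ J) ≫ (λ_ (I ⊗ J)).hom =
      tensorμ I J I J ≫ ((e ▷ I ≫ (λ_ I).hom) ⊗ₘ (f ▷ J ≫ (λ_ J).hom)) := by
    rw [tensor_left_unitality, idalProd, ← comp_whiskerRight_assoc, Category.assoc, Iso.hom_inv_id,
      Category.comp_id, ← tensorHom_id, ← id_tensorHom_id, tensorμ_natural_assoc]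
    simp
  have h₂ : (I ⊗ J) ◁ idalProd e f ≫ (ρ_ (I ⊗ J)).hom =
      tensorμ I J I J ≫ ((I ◁ e ≫ (ρ_ I).hom) ⊗ₘ (J ◁ f ≫ (ρ_ J).hom)) := by
    rw [tensor_right_unitality, idalProd, ← MonoidalCategory.whiskerLeft_comp_assoc,
      Category.assoc, Iso.hom_inv_id, Category.comp_id, ← id_tensorHom, ← id_tensorHom_id,
      tensorμ_natural_assoc]
    simp
  rw [IsIdal, h₁, h₂, he, hf]

/-- The isomorphism `X ⊗ (J ⊗ Y) ≅ J ⊗ (X ⊗ Y)` given by the braiding. -/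
def tensorLeftComm (X J Y : C) : X ⊗ (J ⊗ Y) ≅ J ⊗ (X ⊗ Y) :=
  (α_ X J Y).symm ≪≫ whiskerRightIso (β_ X J) Y ≪≫ α_ J X Y

lemma whiskerLeft_whiskerRight_comp_leftUnitor {J : C} (f : J ⟶ 𝟙_ C) (X Y : C) :
    X ◁ (f ▷ Y ≫ (λ_ Y).hom) =
      (tensorLeftComm X J Y).hom ≫ f ▷ (X ⊗ Y) ≫ (λ_ (X ⊗ Y)).hom := by
  have h : (β_ X J).hom ▷ Y ≫ f ▷ X ▷ Y = (X ◁ f) ▷ Y ≫ (β_ X (𝟙_ C)).hom ▷ Y := by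
    rw [← comp_whiskerRight, ← comp_whiskerRight, BraidedCategory.braiding_naturality_right]
  simp [tensorLeftComm, reassoc_of% h]

variable [∀ X : C, PreservesColimits (tensorLeft X)]

/-- The well-copointed endofunctor `I ⊗ -` defined by a finitely presentable idal `e : I ⟶ 𝟙_ C`,
with copoint `e ⊗ -`. -/
noncomputable def WellCopointed.ofIdal (hC : IsLocallyFinitelyPresentableTensor C) {I : C}
    (hI : IsFinitelyPresentable.{v} I) {e : I ⟶ 𝟙_ C} (he : IsIdal e) : WellCopointed C :=
  have := hC.isLocallyFinitelyPresentable
  have : (tensorLeft I).IsLeftAdjoint := isLeftAdjoint_of_preservesColimits _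
  { S := tensorLeft I
    T := (tensorLeft I).rightAdjoint
    adj := Adjunction.ofIsLeftAdjoint _
    ε := fun X ↦ e ▷ X ≫ (λ_ X).hom
    ε_naturality := fun f ↦ by
      dsimp
      rw [whisker_exchange_assoc, leftUnitor_naturality, Category.assoc]
    map_ε := he.whiskerLeft_eq
    isFinitelyPresentable_obj := fun X hX ↦ hC.tensor I X hI hX }

namespace WellCopointed

variable (hC : IsLocallyFinitelyPresentableTensor C) {I J : C}
    (hI : IsFinitelyPresentable.{v} I) (hJ : IsFinitelyPresentable.{v} J)
    {e : I ⟶ 𝟙_ C} {f : J ⟶ 𝟙_ C} (he : IsIdal e) (hf : IsIdal f)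

lemma ofIdal_commutes : Commutes (ofIdal hC hI he) (ofIdal hC hJ hf) := fun X ↦
  ⟨tensorLeftComm I J X, whiskerLeft_whiskerRight_comp_leftUnitor f I X⟩

/-- Tensoring the pushout square of the cover with `X` gives a pushout square. -/
lemma ofIdal_isCover [∀ X : C, PreservesColimits (tensorRight X)] (h : IsIdalCover e f) :
    IsCover (ofIdal hC hI he) (ofIdal hC hJ hf) := fun X ↦ by
  refine (h.isPushout.map (tensorRight X)).of_iso (α_ I J X) (Iso.refl _) (Iso.refl _) (λ_ X)
    ?_ ?_ ?_ ?_
  · dsimp [ofIdal]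
    simp
  · dsimp [ofIdal]
    simp
  · dsimp [ofIdal]
    simp
  · dsimp [ofIdal]
    simp

/-- The copoint of `e ⊗ f` is a composition of copoints of `e` and `f`. -/
lemma isLocal_ofIdal_idalProd (hIJ : IsFinitelyPresentable.{v} (I ⊗ J)) {Z : C}
    (hZ : (ofIdal hC hI he).IsLocal Z) (hZ' : (ofIdal hC hJ hf).IsLocal Z) :
    (ofIdal hC hIJ (isIdal_idalProd he hf)).IsLocal Z := by
  have := hC.isLocallyFinitelyPresentable
  refine isLocal_of_bijective fun X _ ↦ ?_
  have h : (ofIdal hC hIJ (isIdal_idalProd he hf)).ε X =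
    (α_ I J X).hom ≫ (ofIdal hC hI he).ε (J ⊗ X) ≫ (ofIdal hC hJ hf).ε X := by
    change idalProd e f ▷ X ≫ (λ_ X).hom = _ ≫ (e ▷ (J ⊗ X) ≫ (λ_ (J ⊗ X)).hom) ≫
      (f ▷ X ≫ (λ_ X).hom)
    simp [idalProd_eq_left]
  have h' : (fun a : X ⟶ Z ↦ (ofIdal hC hIJ (isIdal_idalProd he hf)).ε X ≫ a) =
      (fun a ↦ (α_ I J X).hom ≫ a) ∘ (fun a ↦ (ofIdal hC hI he).ε (J ⊗ X) ≫ a) ∘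
      (fun a : X ⟶ Z ↦ (ofIdal hC hJ hf).ε X ≫ a) := by
    ext a
    simp only [h, Function.comp_apply]
    exact (Category.assoc _ _ _).trans (congr_arg ((α_ I J X).hom ≫ ·) (Category.assoc _ _ _))
  rw [h']
  exact ((α_ I J X).symm.homFromEquiv (Z := Z)).bijective.comp
    ((hZ.bijective _).comp (hZ'.bijective _))

end WellCopointed

end Idal

/-! ### Tensor functors out of a localization -/

section LocalizationFunctors

open Functor.LaxMonoidal Functor.OplaxMonoidal

variable {C L D : Type u} [Category.{v} C] [Category.{v} L] [Category.{v} D]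

/-- If `R` is a reflector, then a functor preserves colimits if it does so after composition
with `R`. -/
lemma preservesColimits_of_reflector_comp {R : C ⥤ L} {ι : L ⥤ C} (adj : R ⊣ ι) [ι.Full]
    [ι.Faithful] [HasColimits C] {F : C ⥤ D} {G : L ⥤ D} (i : R ⋙ G ≅ F)
    [PreservesColimits F] : PreservesColimits G where
  preservesColimitsOfShape {J _} :=
    { preservesColimit := fun {K} ↦ by
        have : PreservesColimits R := adj.leftAdjoint_preservesColimits
        have : PreservesColimits (R ⋙ G) := preservesColimits_of_natIso i.symm
        have hc := colimit.isColimit (K ⋙ ι)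
        have h₁ := isColimitOfPreserves R hc
        have h₂ : IsColimit (G.mapCocone (R.mapCocone (colimit.cocone (K ⋙ ι)))) :=
          isColimitOfPreserves (R ⋙ G) hc
        have : PreservesColimit ((K ⋙ ι) ⋙ R) G := preservesColimit_of_preserves_colimit_cocone
          h₁ h₂
        exact preservesColimit_of_iso_diagram G
          (Functor.associator _ _ _ ≪≫ Functor.isoWhiskerLeft K (asIso adj.counit) ≪≫
            K.rightUnitor) }

variable [MonoidalCategory C] [MonoidalCategory L] [MonoidalCategory D]

/-- Whether a natural transformation is monoidal may be tested after composition with an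
essentially surjective monoidal functor. -/
lemma isMonoidal_of_whiskerLeft (R : C ⥤ L) [R.Monoidal] [R.EssSurj] {G H : L ⥤ D} [G.Monoidal]
    [H.Monoidal] (η : G ⟶ H) (h : NatTrans.IsMonoidal (Functor.whiskerLeft R η)) :
    NatTrans.IsMonoidal η where
  unit := by
    have h₁ := h.unit
    rw [comp_ε, comp_ε] at h₁
    simp only [Functor.whiskerLeft_app, Category.assoc, NatTrans.naturality] at h₁
    rw [← Category.assoc, cancel_mono] at h₁
    exact h₁
  tensor A B := by
    have h₁ := h.tensor (R.objPreimage A) (R.objPreimage B)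
    rw [comp_μ, comp_μ] at h₁
    simp only [Functor.whiskerLeft_app, Category.assoc, NatTrans.naturality] at h₁
    rw [← Category.assoc, ← Category.assoc, cancel_mono] at h₁
    let a := R.objObjPreimageIso A
    let b := R.objObjPreimageIso B
    rw [← cancel_epi (G.map a.hom ⊗ₘ G.map b.hom), μ_natural_assoc, NatTrans.naturality,
      MonoidalCategory.tensorHom_comp_tensorHom_assoc, NatTrans.naturality, NatTrans.naturality,
      ← MonoidalCategory.tensorHom_comp_tensorHom_assoc, μ_natural, ← Category.assoc,
      ← Category.assoc, h₁]

/-- Whether a monoidal functor is braided may be tested after composition with an essentially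
surjective braided functor. -/
lemma map_braiding_of_comp [BraidedCategory C] [BraidedCategory L] [BraidedCategory D] (R : C ⥤ L)
    [R.Braided] [R.EssSurj] {G : L ⥤ D} [G.Monoidal] {F : C ⥤ D} [F.Braided] (i : R ⋙ G ≅ F)
    (h : NatTrans.IsMonoidal i.hom) (A B : L) :
    μ G A B ≫ G.map (β_ A B).hom = (β_ (G.obj A) (G.obj B)).hom ≫ μ G B A := by
  have key (X Y : C) : μ G (R.obj X) (R.obj Y) ≫ G.map (β_ (R.obj X) (R.obj Y)).hom =
      (β_ (G.obj (R.obj X)) (G.obj (R.obj Y))).hom ≫ μ G (R.obj Y) (R.obj X) := by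
    have h₁ : μ (R ⋙ G) X Y ≫ (R ⋙ G).map (β_ X Y).hom =
        (β_ ((R ⋙ G).obj X) ((R ⋙ G).obj Y)).hom ≫ μ (R ⋙ G) Y X := by
      rw [← cancel_mono (i.hom.app (Y ⊗ X))]
      simp only [Category.assoc, NatTrans.naturality, h.tensor, h.tensor_assoc,
        Functor.LaxBraided.braided]
      rw [BraidedCategory.braiding_naturality_assoc]
    rw [comp_μ, comp_μ, Functor.comp_map, Category.assoc, ← G.map_comp,
      Functor.LaxBraided.braided, G.map_comp, ← Category.assoc, ← Category.assoc, cancel_mono] at h₁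
    exact h₁
  let a := R.objObjPreimageIso A
  let b := R.objObjPreimageIso B
  rw [← cancel_epi (G.map a.hom ⊗ₘ G.map b.hom), μ_natural_assoc, ← G.map_comp,
    BraidedCategory.braiding_naturality, G.map_comp, ← Category.assoc, key, Category.assoc,
    ← μ_natural, BraidedCategory.braiding_naturality_assoc]

end LocalizationFunctors

namespace CocompleteTensorCat

variable {C L : CocompleteTensorCat.{v, u}} (R : C ⟶ L) (W : MorphismProperty C)
  [R.functor.IsLocalization W]

lemma existsUnique_whiskerLeft_eq [W.ContainsIdentities] {D : CocompleteTensorCat.{v, u}}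
    (G H : L ⟶ D) (θ : R ≫ G ⟶ R ≫ H) :
    ∃! η : G ⟶ H, whiskerLeft R η = θ := by
  have : R.functor.EssSurj := Localization.essSurj R.functor W
  let η : G.functor ⟶ H.functor := Localization.liftNatTrans R.functor W
    (R.functor ⋙ G.functor) (R.functor ⋙ H.functor) G.functor H.functor θ.natTrans
  have hη : Functor.whiskerLeft R.functor η = θ.natTrans := by
    ext X
    simp [η]
  refine ⟨{ natTrans := η, isMonoidal := isMonoidal_of_whiskerLeft R.functor η ?_ }, ?_, ?_⟩
  · rw [hη]
    exact θ.isMonoidal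
  · exact hom₂_ext hη
  · intro η' h'
    apply hom₂_ext
    apply Localization.natTrans_ext R.functor W
    intro X
    have := NatTrans.congr_app ((congr_arg Hom₂.natTrans h').trans hη.symm) X
    exact this

/-- Tensor functors which invert `W` factor through a reflective localization at `W`. -/
lemma exists_lift [W.ContainsIdentities] {ι : L ⥤ C} (adj : R.functor ⊣ ι) [ι.Full] [ι.Faithful]
    {D : CocompleteTensorCat.{v, u}} (F : C ⟶ D) (hF : W.IsInvertedBy F.functor) :
    ∃ G : L ⟶ D, Nonempty (R ≫ G ≅ F) := by
  have : R.functor.EssSurj := Localization.essSurj R.functor W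
  let G : L ⥤ D := Localization.lift F.functor hF R.functor
  let : G.Monoidal := Localization.Monoidal.functorMonoidalOfComp R.functor W G F.functor
  let i : R.functor ⋙ G ≅ F.functor := Localization.Lifting.iso R.functor W F.functor G
  have hi : NatTrans.IsMonoidal i.hom :=
    Localization.Monoidal.lifting_isMonoidal R.functor W G F.functor
  let : G.Braided := { braided := map_braiding_of_comp R.functor i hi }
  have : PreservesColimits G := preservesColimits_of_reflector_comp adj i
  exact ⟨{ functor := G }, ⟨isoMk (F := R ≫ { functor := G }) i hi⟩⟩

/-- A reflective localization of the underlying categories is a localization of tensor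
categories. -/
lemma isLocalizationAt [W.ContainsIdentities] {ι : L ⥤ C} (adj : R.functor ⊣ ι) [ι.Full]
    [ι.Faithful] (P : ∀ ⦃D : CocompleteTensorCat.{v, u}⦄, (C ⟶ D) → Prop) (hR : P R)
    (hP : ∀ ⦃D : CocompleteTensorCat.{v, u}⦄ (F : C ⟶ D), P F → W.IsInvertedBy F.functor) :
    IsLocalizationAt P R where
  mem := hR
  exists_lift _ F hF := exists_lift R W adj F (hP F hF)
  existsUnique_lift _ G H θ := existsUnique_whiskerLeft_eq R W G H θ

end CocompleteTensorCat

/-! ### The localized tensor category -/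

namespace WellCopointed

section Reflector

variable {C : Type u} [Category.{v} C] [IsLocallyFinitelyPresentable.{v} C] (E : WellCopointed C)

/-- Morphisms from the reflection of `M` to a local object correspond to morphisms from `M`. -/
noncomputable def reflEquiv (M : C) (Z : E.IsLocal.FullSubcategory) :
    ((⟨E.refl M, E.isLocal_refl M⟩ : E.IsLocal.FullSubcategory) ⟶ Z) ≃ (M ⟶ E.IsLocal.ι.obj Z) :=
  E.IsLocal.fullyFaithfulι.homEquiv.trans
    (Equiv.ofBijective _ (Z.property.bijective_toRefl M))

/-- The left adjoint of the inclusion of the local objects. -/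
noncomputable def reflector : C ⥤ E.IsLocal.FullSubcategory :=
  Adjunction.leftAdjointOfEquiv (G := E.IsLocal.ι) E.reflEquiv
    fun _ _ _ _ _ ↦ (Category.assoc _ _ _).symm

/-- The adjunction between the reflector and the inclusion of the local objects. -/
noncomputable def reflectorAdj : E.reflector ⊣ E.IsLocal.ι :=
  Adjunction.adjunctionOfEquivLeft (G := E.IsLocal.ι) E.reflEquiv
    fun _ _ _ _ _ ↦ (Category.assoc _ _ _).symm

lemma isReflector_reflector : E.IsReflector E.reflector where
  isIso_map_ε X := by
    rw [isIso_iff_coyoneda_map_bijective]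
    intro Z
    have h : (fun a : E.reflector.obj X ⟶ Z ↦ E.reflector.map (E.ε X) ≫ a) =
        (E.reflectorAdj.homEquiv _ _).symm ∘ (fun a : X ⟶ Z.obj ↦ E.ε X ≫ a) ∘
          E.reflectorAdj.homEquiv _ _ := by
      funext a
      apply (E.reflectorAdj.homEquiv _ _).injective
      simp [E.reflectorAdj.homEquiv_naturality_left]
    rw [h]
    exact (E.reflectorAdj.homEquiv _ _).symm.bijective.comp
      ((Z.property.bijective X).comp (E.reflectorAdj.homEquiv _ _).bijective)
  exists_rightAdjoint := ⟨E.IsLocal.ι, E.reflectorAdj, inferInstance, inferInstance,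
    fun Z hZ ↦ ⟨⟨Z, hZ⟩, ⟨Iso.refl _⟩⟩⟩

instance : E.reflector.IsLocalization E.LocallyBijective := by
  have h : (MorphismProperty.isomorphisms _).inverseImage E.reflector = E.LocallyBijective := by
    ext M N φ
    exact E.isReflector_reflector.isIso_map_iff φ
  exact h ▸ E.reflectorAdj.isLocalization

variable {E} in
/-- A functor which preserves sequential colimits and inverts the copoint inverts all locally
bijective morphisms, because it inverts the maps to the reflections. -/
lemma LocallyBijective.isIso_map {D : Type*} [Category* D] (F : C ⥤ D)
    [PreservesColimitsOfShape ℕ F] (hF : ∀ X, IsIso (F.map (E.ε X))) {M N : C} {φ : M ⟶ N}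
    (hφ : E.LocallyBijective φ) : IsIso (F.map φ) := by
  obtain ⟨ψ, hψ⟩ := ((E.isLocal_refl N).bijective_toRefl M).2 (φ ≫ E.toRefl N)
  have h₁ : E.LocallyBijective ψ := by
    refine E.LocallyBijective.of_precomp (W' := E.LocallyBijective) _ ψ
      (E.locallyBijective_toRefl M) ?_
    dsimp only at hψ
    rw [hψ]
    exact E.LocallyBijective.comp_mem _ _ hφ (E.locallyBijective_toRefl N)
  have := h₁.isIso (E.isLocal_refl M) (E.isLocal_refl N)
  have := E.isIso_map_toRefl F hF M
  have := E.isIso_map_toRefl F hF N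
  have h₂ := congr_arg F.map hψ
  rw [F.map_comp, F.map_comp] at h₂
  have : IsIso (F.map φ ≫ F.map (E.toRefl N)) := h₂ ▸ inferInstance
  exact IsIso.of_isIso_comp_right (F.map φ) (F.map (E.toRefl N))

end Reflector

variable {C : CocompleteTensorCat.{v, u}} [IsLocallyFinitelyPresentable.{v} C]
  (E : WellCopointed C)

/-- The functor which reflects `X ⊗ -` inverts all locally bijective morphisms as soon as it inverts
the copoint. -/
lemma isMonoidal_locallyBijective
    (h : ∀ X Y : C, IsIso (E.reflector.map (X ◁ E.ε Y))) : E.LocallyBijective.IsMonoidal := by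
  have key (X : C) {M N : C} (φ : M ⟶ N) (hφ : E.LocallyBijective φ) :
      E.LocallyBijective (X ◁ φ) := by
    have : PreservesColimitsOfSize.{0, 0} E.reflector :=
      E.reflectorAdj.leftAdjoint_preservesColimits
    have : PreservesColimitsOfSize.{0, 0} (tensorLeft X) :=
      preservesColimitsOfSize_shrink.{0, v, 0, v} _
    rw [← E.isReflector_reflector.isIso_map_iff]
    exact hφ.isIso_map (tensorLeft X ⋙ E.reflector) (h X)
  exact
    { whiskerLeft := fun X _ _ φ hφ ↦ key X φ hφ
      whiskerRight := fun φ hφ Y ↦ by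
        have h := key Y φ hφ
        rw [← E.isReflector_reflector.isIso_map_iff] at h ⊢
        have : φ ▷ Y = (β_ _ Y).hom ≫ Y ◁ φ ≫ (β_ _ Y).inv := by
          rw [← BraidedCategory.braiding_naturality_left_assoc, Iso.hom_inv_id, Category.comp_id]
        rw [this, Functor.map_comp, Functor.map_comp]
        infer_instance }

variable [E.LocallyBijective.IsMonoidal]

/-- The category of local objects with the localized tensor product, that is the reflection of the
tensor product in `C`. -/
noncomputable def localization : CocompleteTensorCat.{v, u} :=
  let L := LocalizedMonoidal E.reflector E.LocallyBijective (Iso.refl _)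
  let R : C ⥤ L :=
    Localization.Monoidal.toMonoidalCategory E.reflector E.LocallyBijective (Iso.refl _)
  let ι : L ⥤ C := E.IsLocal.ι
  let adj : R ⊣ ι := E.reflectorAdj
  have : ι.Full := inferInstanceAs E.IsLocal.ι.Full
  have : ι.Faithful := inferInstanceAs E.IsLocal.ι.Faithful
  have : R.EssSurj := Localization.essSurj R E.LocallyBijective
  have : PreservesColimits R := adj.leftAdjoint_preservesColimits
  have h (A : L) : PreservesColimits (tensorLeft A) := by
    have := preservesColimits_of_reflector_comp adj
      (Functor.Monoidal.commTensorLeft R (R.objPreimage A))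
    exact preservesColimits_of_natIso ((curriedTensor L).mapIso (R.objObjPreimageIso A))
  { carrier := L
    hasColimits := by
      let : Reflective ι := ⟨_, adj⟩
      exact hasColimits_of_reflective ι
    tensorLeft_preservesColimits := h
    tensorRight_preservesColimits := fun A ↦
      preservesColimits_of_natIso (BraidedCategory.tensorLeftIsoTensorRight A) }

/-- The localization functor. -/
noncomputable def toLocalization : C ⟶ E.localization :=
  have : PreservesColimits E.reflector := E.reflectorAdj.leftAdjoint_preservesColimits
  { functor := Localization.Monoidal.toMonoidalCategory E.reflector E.LocallyBijective (Iso.refl _)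
    braided := by
      let i : (Localization.Monoidal.toMonoidalCategory E.reflector
        E.LocallyBijective (Iso.refl _)).Braided := inferInstance
      exact i
    preservesColimits := this }

lemma isReflector_toLocalization : E.IsReflector E.toLocalization.functor :=
  E.isReflector_reflector

/-- If locally bijective morphisms are stable under tensor products, then the category of local
objects is the universal tensor category in which the copoint becomes invertible. -/
lemma isLocalizationAt_toLocalization (P : ∀ ⦃D : CocompleteTensorCat.{v, u}⦄, (C ⟶ D) → Prop)
    (hR : P E.toLocalization) (hP : ∀ ⦃D : CocompleteTensorCat.{v, u}⦄ (F : C ⟶ D), P F →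
      ∀ X, IsIso (F.functor.map (E.ε X))) :
    IsLocalizationAt P E.toLocalization := by
  have : E.toLocalization.functor.IsLocalization E.LocallyBijective :=
    inferInstanceAs (E.reflector.IsLocalization _)
  obtain ⟨ι, adj, _, _, -⟩ := E.isReflector_toLocalization.exists_rightAdjoint
  exact CocompleteTensorCat.isLocalizationAt E.toLocalization E.LocallyBijective adj P hR
    fun D F hF M N φ hφ ↦ by
      have : PreservesColimitsOfSize.{0, 0} F.functor :=
        preservesColimitsOfSize_shrink.{0, v, 0, v} _
      exact hφ.isIso_map F.functor (hP F hF)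

end WellCopointed

/-! ### Uniqueness of localizations -/

section Bicategorical

open Bicategory

universe w' v' u'

variable {B : Type u'} [Bicategory.{w', v'} B] {C : B}

namespace IsLocalizationAt

variable {W : ∀ ⦃D : B⦄, (C ⟶ D) → Prop} {L : B} {R : C ⟶ L}

lemma nonempty_iso (hR : IsLocalizationAt W R) {D : B} {G H : L ⟶ D} (θ : R ≫ G ≅ R ≫ H) :
    Nonempty (G ≅ H) := by
  obtain ⟨η, hη, -⟩ := hR.existsUnique_lift G H θ.hom
  obtain ⟨ζ, hζ, -⟩ := hR.existsUnique_lift H G θ.inv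
  refine ⟨η, ζ, ?_, ?_⟩
  · exact (hR.existsUnique_lift G G (𝟙 _)).unique
      (by rw [Bicategory.whiskerLeft_comp, hη, hζ, Iso.hom_inv_id]) (Bicategory.whiskerLeft_id _ _)
  · exact (hR.existsUnique_lift H H (𝟙 _)).unique
      (by rw [Bicategory.whiskerLeft_comp, hη, hζ, Iso.inv_hom_id]) (Bicategory.whiskerLeft_id _ _)

/-- Two localizations at the same class of 1-morphisms are equivalent. -/
lemma exists_equivalence (hR : IsLocalizationAt W R) {L' : B} {R' : C ⟶ L'}
    (hR' : IsLocalizationAt W R') :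
    ∃ (G : L ⟶ L') (H : L' ⟶ L), Nonempty (R ≫ G ≅ R') ∧ Nonempty (G ≫ H ≅ 𝟙 L) ∧
      Nonempty (H ≫ G ≅ 𝟙 L') := by
  obtain ⟨G, ⟨i⟩⟩ := hR.exists_lift R' hR'.mem
  obtain ⟨H, ⟨j⟩⟩ := hR'.exists_lift R hR.mem
  exact ⟨G, H, ⟨i⟩,
    hR.nonempty_iso
      ((Bicategory.associator _ _ _).symm ≪≫ whiskerRightIso i H ≪≫ j ≪≫ (rightUnitor R).symm),
    hR'.nonempty_iso
      ((Bicategory.associator _ _ _).symm ≪≫ whiskerRightIso j G ≪≫ i ≪≫ (rightUnitor R').symm)⟩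

end IsLocalizationAt

/-- A square of localizations exists if inverting what is inverted by `W₁₂` inverts what is inverted
by `W₁` and by `W₂`. -/
lemma LocalizationSquare.nonempty_of_isLocalizationAt {W₁ W₂ W₁₂ : ∀ ⦃D : B⦄, (C ⟶ D) → Prop}
    {C₁ C₂ C₁₂ : B} {R₁ : C ⟶ C₁} {R₂ : C ⟶ C₂} {R₁₂ : C ⟶ C₁₂} (h₁ : IsLocalizationAt W₁ R₁)
    (h₂ : IsLocalizationAt W₂ R₂) (h₁₂ : IsLocalizationAt W₁₂ R₁₂) (hW₁ : W₁ R₁₂) (hW₂ : W₂ R₁₂) :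
    Nonempty (LocalizationSquare C W₁ W₂ W₁₂) := by
  obtain ⟨G₁, ⟨i₁⟩⟩ := h₁.exists_lift R₁₂ hW₁
  obtain ⟨G₂, ⟨i₂⟩⟩ := h₂.exists_lift R₁₂ hW₂
  exact ⟨⟨_, _, _, R₁, R₂, R₁₂, h₁, h₂, h₁₂, G₁, G₂, i₁, i₂⟩⟩

end Bicategorical

namespace WellCopointed

/-- If one localization is a reflector onto the local objects, then so is every other one. -/
lemma IsReflector.of_isLocalizationAt {C : CocompleteTensorCat.{v, u}} {E : WellCopointed C}
    {P : ∀ ⦃D : CocompleteTensorCat.{v, u}⦄, (C ⟶ D) → Prop} {L L' : CocompleteTensorCat.{v, u}}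
    {R : C ⟶ L} {R' : C ⟶ L'} (h : E.IsReflector R.functor) (hR : IsLocalizationAt P R)
    (hR' : IsLocalizationAt P R') : E.IsReflector R'.functor := by
  obtain ⟨G, H, ⟨i⟩, ⟨j⟩, ⟨k⟩⟩ := hR.exists_equivalence hR'
  have : G.functor.IsEquivalence := (CategoryTheory.Equivalence.mk G.functor H.functor
    ((CocompleteTensorCat.forget _ _).mapIso j).symm
    ((CocompleteTensorCat.forget _ _).mapIso k)).isEquivalence_functor
  exact h.of_equivalence G.functor ((CocompleteTensorCat.forget _ _).mapIso i)

lemma IsReflector.of_isLocalizationAt_linear {K : Type w} [CommRing K]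
    {C : LinearCocompleteTensorCat.{w, v, u} K} {E : WellCopointed C}
    {P : ∀ ⦃D : LinearCocompleteTensorCat.{w, v, u} K⦄, (C ⟶ D) → Prop}
    {L L' : LinearCocompleteTensorCat.{w, v, u} K} {R : C ⟶ L} {R' : C ⟶ L'}
    (h : E.IsReflector R.toTensor.functor) (hR : IsLocalizationAt P R)
    (hR' : IsLocalizationAt P R') : E.IsReflector R'.toTensor.functor := by
  obtain ⟨G, H, ⟨i⟩, ⟨j⟩, ⟨k⟩⟩ := hR.exists_equivalence hR'
  let U (A B : LinearCocompleteTensorCat.{w, v, u} K) : (A ⟶ B) ⥤ (A ⥤ B) :=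
    LinearCocompleteTensorCat.forget A B ⋙ CocompleteTensorCat.forget _ _
  have : G.toTensor.functor.IsEquivalence :=
    (CategoryTheory.Equivalence.mk G.toTensor.functor H.toTensor.functor
      ((U _ _).mapIso j).symm ((U _ _).mapIso k)).isEquivalence_functor
  exact h.of_equivalence G.toTensor.functor ((U _ _).mapIso i)

section Idal

variable {C : CocompleteTensorCat.{v, u}} (hC : IsLocallyFinitelyPresentableTensor C) {I : C}
  (hI : IsFinitelyPresentable.{v} I) {e : I ⟶ 𝟙_ C} (he : IsIdal e)

/-- Up to an isomorphism, `X ⊗ ε_Y` is `ε_{X ⊗ Y}`. -/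
lemma isMonoidal_locallyBijective_ofIdal :
    (ofIdal hC hI he).LocallyBijective.IsMonoidal := by
  have := hC.isLocallyFinitelyPresentable
  refine isMonoidal_locallyBijective _ fun X Y ↦ ?_
  have : IsIso ((ofIdal hC hI he).reflector.map (e ▷ (X ⊗ Y) ≫ (λ_ (X ⊗ Y)).hom)) :=
    (ofIdal hC hI he).isReflector_reflector.isIso_map_ε (X ⊗ Y)
  change IsIso ((ofIdal hC hI he).reflector.map (X ◁ (e ▷ Y ≫ (λ_ Y).hom)))
  rw [whiskerLeft_whiskerRight_comp_leftUnitor, Functor.map_comp]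
  infer_instance

lemma isIso_map_of_isReflector_ofIdal {D : Type*} [Category* D] {R : C ⥤ D}
    (hR : (ofIdal hC hI he).IsReflector R) : IsIso (R.map e) := by
  have h : e = (ρ_ I).inv ≫ e ▷ 𝟙_ C ≫ (λ_ (𝟙_ C)).hom := by simp [unitors_equal]
  have : IsIso (R.map (e ▷ 𝟙_ C ≫ (λ_ (𝟙_ C)).hom)) := hR.isIso_map_ε (𝟙_ C)
  rw [h, R.map_comp]
  infer_instance

lemma isIso_map_ε_ofIdal {D : CocompleteTensorCat.{v, u}} (F : C ⟶ D)
    (hF : IsIso (F.functor.map e)) (X : C) : IsIso (F.functor.map ((ofIdal hC hI he).ε X)) :=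
  map_whiskerRight_comp_leftUnitor F.functor e hF X

end Idal

end WellCopointed

/-! ### Lifting functors to a category of triples -/

section Triples

universe v₀ v₁ v₂ v₃ v₄ u₀ u₁ u₂ u₃ u₄

variable {C : Type u₀} [Category.{v₀} C] {C₁ : Type u₁} [Category.{v₁} C₁]
  {C₂ : Type u₂} [Category.{v₂} C₂] {C₁₂ : Type u₃} [Category.{v₃} C₁₂]
  {R₁ : C ⥤ C₁} {R₂ : C ⥤ C₂} {Q₁ : C₁ ⥤ C₁₂} {Q₂ : C₂ ⥤ C₁₂} (σ : R₁ ⋙ Q₁ ≅ R₂ ⋙ Q₂)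

lemma hom_ext_of_faithful_toTriples [(toTriples σ).Faithful] {M N : C} {φ ψ : M ⟶ N}
    (h₁ : R₁.map φ = R₁.map ψ) (h₂ : R₂.map φ = R₂.map ψ) : φ = ψ :=
  (toTriples σ).map_injective (CategoricalPullback.hom_ext h₁ h₂)

lemma isIso_of_reflectsIsomorphisms_toTriples [(toTriples σ).ReflectsIsomorphisms] {M N : C}
    (φ : M ⟶ N) (h₁ : IsIso (R₁.map φ)) (h₂ : IsIso (R₂.map φ)) : IsIso φ := by
  have : IsIso ((toTriples σ).map φ) := (CategoricalPullback.isIso_iff _ _ _).2 ⟨h₁, h₂⟩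
  exact isIso_of_reflects_iso φ (toTriples σ)

lemma exists_map_eq_of_full_toTriples [(toTriples σ).Full] {M N : C}
    (φ₁ : R₁.obj M ⟶ R₁.obj N) (φ₂ : R₂.obj M ⟶ R₂.obj N)
    (w : Q₁.map φ₁ ≫ σ.hom.app N = σ.hom.app M ≫ Q₂.map φ₂) :
    ∃ φ : M ⟶ N, R₁.map φ = φ₁ ∧ R₂.map φ = φ₂ := by
  let ψ : (toTriples σ).obj M ⟶ (toTriples σ).obj N := ⟨φ₁, φ₂, w⟩
  obtain ⟨φ, hφ⟩ := (toTriples σ).map_surjective ψ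
  exact ⟨φ, congr_arg CategoricalPullback.Hom.fst hφ, congr_arg CategoricalPullback.Hom.snd hφ⟩

/-- If `C` is the category of triples, then functors to `C` may be glued. -/
lemma exists_functor_of_isEquivalence_toTriples [(toTriples σ).IsEquivalence] {T : Type u₄}
    [Category.{v₄} T] (a : T ⥤ C₁) (b : T ⥤ C₂) (τ : a ⋙ Q₁ ≅ b ⋙ Q₂) :
    ∃ (t : T ⥤ C) (i : t ⋙ R₁ ≅ a) (j : t ⋙ R₂ ≅ b), ∀ x,
      Q₁.map (i.hom.app x) ≫ τ.hom.app x = σ.hom.app (t.obj x) ≫ Q₂.map (j.hom.app x) := by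
  let c : T ⥤ CategoricalPullback Q₁ Q₂ :=
    { obj := fun x ↦ ⟨a.obj x, b.obj x, τ.app x⟩
      map := fun φ ↦ ⟨a.map φ, b.map φ, τ.hom.naturality φ⟩ }
  let k : (c ⋙ (toTriples σ).inv) ⋙ toTriples σ ≅ c :=
    Functor.associator _ _ _ ≪≫ Functor.isoWhiskerLeft c (toTriples σ).asEquivalence.counitIso ≪≫
      c.rightUnitor
  exact ⟨c ⋙ (toTriples σ).inv,
    Functor.isoWhiskerRight k (CategoricalPullback.π₁ Q₁ Q₂),
    Functor.isoWhiskerRight k (CategoricalPullback.π₂ Q₁ Q₂), fun x ↦ (k.hom.app x).w⟩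

end Triples

section Monoidal

open Functor.LaxMonoidal Functor.OplaxMonoidal

universe v₀ v₁ v₂ v₃ v₄ u₀ u₁ u₂ u₃ u₄

/-- The morphisms `e` and `m` are compatible with the structure morphisms of the monoidal functors
`R` and `a` under the isomorphism `i : t ⋙ R ≅ a`. In this situation the axioms of a monoidal
functor hold for `t`, `e` and `m` after application of `R`. -/
structure LiftsMonoidal {T : Type u₄} [Category.{v₄} T] [MonoidalCategory T] {C : Type u₀}
    [Category.{v₀} C] [MonoidalCategory C] {D : Type u₁} [Category.{v₁} D] [MonoidalCategory D]
    {t : T ⥤ C} {R : C ⥤ D} [R.Monoidal] {a : T ⥤ D} [a.Monoidal] (i : t ⋙ R ≅ a)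
    (e : 𝟙_ C ⟶ t.obj (𝟙_ T)) (m : ∀ x y, t.obj x ⊗ t.obj y ⟶ t.obj (x ⊗ y)) : Prop where
  unit : ε R ≫ R.map e ≫ i.hom.app (𝟙_ T) = ε a
  tensor (x y : T) : μ R _ _ ≫ R.map (m x y) ≫ i.hom.app (x ⊗ y) =
    (i.hom.app x ⊗ₘ i.hom.app y) ≫ μ a x y

namespace LiftsMonoidal

variable {T : Type u₄} [Category.{v₄} T] [MonoidalCategory T] {C : Type u₀}
    [Category.{v₀} C] [MonoidalCategory C] {D : Type u₁} [Category.{v₁} D] [MonoidalCategory D]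
    {t : T ⥤ C} {R : C ⥤ D} [R.Monoidal] {a : T ⥤ D} [a.Monoidal] {i : t ⋙ R ≅ a}
    {e : 𝟙_ C ⟶ t.obj (𝟙_ T)} {m : ∀ x y, t.obj x ⊗ t.obj y ⟶ t.obj (x ⊗ y)}

section

variable (h : LiftsMonoidal i e m)

include h

lemma naturality_left {x y : T} (φ : x ⟶ y) (z : T) :
    R.map (t.map φ ▷ t.obj z ≫ m y z) = R.map (m x z ≫ t.map (φ ▷ z)) := by
  have hn {x y : T} (φ : x ⟶ y) : R.map (t.map φ) ≫ i.hom.app y = i.hom.app x ≫ a.map φ :=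
    i.hom.naturality φ
  have hi : IsIso (i.hom.app (y ⊗ z)) := inferInstance
  rw [← cancel_epi (μ R _ _), ← cancel_mono (i.hom.app (y ⊗ z))]
  simp only [R.map_comp, Category.assoc, hn, reassoc_of% h.tensor, h.tensor,
    ← μ_natural_left_assoc, ← μ_natural_left]
  rw [← tensorHom_id, ← tensorHom_id, MonoidalCategory.tensorHom_comp_tensorHom_assoc,
    MonoidalCategory.tensorHom_comp_tensorHom_assoc, hn, Category.id_comp, Category.comp_id]

lemma naturality_right {x y : T} (z : T) (φ : x ⟶ y) :
    R.map (t.obj z ◁ t.map φ ≫ m z y) = R.map (m z x ≫ t.map (z ◁ φ)) := by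
  have hn {x y : T} (φ : x ⟶ y) : R.map (t.map φ) ≫ i.hom.app y = i.hom.app x ≫ a.map φ :=
    i.hom.naturality φ
  rw [← cancel_epi (μ R _ _), ← cancel_mono (i.hom.app (z ⊗ y))]
  simp only [R.map_comp, Category.assoc, hn, reassoc_of% h.tensor, h.tensor,
    ← μ_natural_right_assoc, ← μ_natural_right]
  rw [← id_tensorHom, ← id_tensorHom, MonoidalCategory.tensorHom_comp_tensorHom_assoc,
    MonoidalCategory.tensorHom_comp_tensorHom_assoc, hn, Category.id_comp, Category.comp_id]

lemma associativity (x y z : T) :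
    R.map (m x y ▷ t.obj z ≫ m (x ⊗ y) z ≫ t.map (α_ x y z).hom) =
      R.map ((α_ (t.obj x) (t.obj y) (t.obj z)).hom ≫ t.obj x ◁ m y z ≫ m x (y ⊗ z)) := by
  have hn {x y : T} (φ : x ⟶ y) : R.map (t.map φ) ≫ i.hom.app y = i.hom.app x ≫ a.map φ :=
    i.hom.naturality φ
  rw [← cancel_epi (μ R (t.obj x) (t.obj y) ▷ R.obj (t.obj z) ≫ μ R _ _),
    ← cancel_mono (i.hom.app (x ⊗ y ⊗ z))]
  simp only [R.map_comp, Category.assoc, hn, reassoc_of% h.tensor, h.tensor,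
    ← μ_natural_left_assoc, Functor.LaxMonoidal.associativity_assoc, ← μ_natural_right_assoc,
    Functor.comp_obj, MonoidalCategory.tensorHom_def (i.hom.app (x ⊗ y)),
    MonoidalCategory.tensorHom_def' (i.hom.app x) (i.hom.app (y ⊗ z))]
  rw [← comp_whiskerRight_assoc, ← comp_whiskerRight_assoc, Category.assoc, h.tensor,
    ← MonoidalCategory.whiskerLeft_comp_assoc, ← MonoidalCategory.whiskerLeft_comp_assoc,
    Category.assoc, h.tensor]
  have hα := associator_naturality (i.hom.app x) (i.hom.app y) (i.hom.app z)
  rw [MonoidalCategory.tensorHom_def _ (i.hom.app z), MonoidalCategory.tensorHom_def' (i.hom.app x)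
    (i.hom.app y ⊗ₘ i.hom.app z), Category.assoc] at hα
  rw [comp_whiskerRight_assoc, ← whisker_exchange_assoc, Functor.LaxMonoidal.associativity,
    MonoidalCategory.whiskerLeft_comp_assoc, whisker_exchange_assoc, reassoc_of% hα]

lemma left_unitality (x : T) :
    R.map (λ_ (t.obj x)).hom = R.map (e ▷ t.obj x ≫ m (𝟙_ T) x ≫ t.map (λ_ x).hom) := by
  have hn {x y : T} (φ : x ⟶ y) : R.map (t.map φ) ≫ i.hom.app y = i.hom.app x ≫ a.map φ :=
    i.hom.naturality φ
  rw [← cancel_epi (ε R ▷ _ ≫ μ R (𝟙_ C) (t.obj x)), ← cancel_mono (i.hom.app x)]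
  simp only [R.map_comp, Category.assoc, hn, reassoc_of% h.tensor,
    ← μ_natural_left_assoc, Functor.comp_obj, MonoidalCategory.tensorHom_def (i.hom.app (𝟙_ T))]
  rw [← comp_whiskerRight_assoc, ← comp_whiskerRight_assoc, Category.assoc, h.unit,
    ← Functor.LaxMonoidal.left_unitality_assoc, ← whisker_exchange_assoc,
    ← Functor.LaxMonoidal.left_unitality]
  simp

lemma right_unitality (x : T) :
    R.map (ρ_ (t.obj x)).hom = R.map (t.obj x ◁ e ≫ m x (𝟙_ T) ≫ t.map (ρ_ x).hom) := by
  have hn {x y : T} (φ : x ⟶ y) : R.map (t.map φ) ≫ i.hom.app y = i.hom.app x ≫ a.map φ :=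
    i.hom.naturality φ
  rw [← cancel_epi (_ ◁ ε R ≫ μ R (t.obj x) (𝟙_ C)), ← cancel_mono (i.hom.app x)]
  simp only [R.map_comp, Category.assoc, hn, reassoc_of% h.tensor,
    ← μ_natural_right_assoc, Functor.comp_obj, MonoidalCategory.tensorHom_def' (i.hom.app x)]
  rw [← MonoidalCategory.whiskerLeft_comp_assoc, ← MonoidalCategory.whiskerLeft_comp_assoc,
    Category.assoc, h.unit, ← Functor.LaxMonoidal.right_unitality_assoc, whisker_exchange_assoc,
    ← Functor.LaxMonoidal.right_unitality]
  simp

end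

lemma braided [BraidedCategory T] [BraidedCategory C] [BraidedCategory D] {R : C ⥤ D} [R.Braided]
    {a : T ⥤ D} [a.Braided] {i : t ⋙ R ≅ a} (h : LiftsMonoidal i e m) (x y : T) :
    R.map (m x y ≫ t.map (β_ x y).hom) = R.map ((β_ (t.obj x) (t.obj y)).hom ≫ m y x) := by
  have hn {x y : T} (φ : x ⟶ y) : R.map (t.map φ) ≫ i.hom.app y = i.hom.app x ≫ a.map φ :=
    i.hom.naturality φ
  rw [← cancel_epi (μ R _ _), ← cancel_mono (i.hom.app (y ⊗ x))]
  simp only [R.map_comp, Category.assoc, hn, reassoc_of% h.tensor, h.tensor,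
    Functor.LaxBraided.braided, Functor.LaxBraided.braided_assoc]
  rw [BraidedCategory.braiding_naturality_assoc]

end LiftsMonoidal

end Monoidal

/-! ### Gluing of tensor functors -/

section GluingFunctors

open Functor.LaxMonoidal Functor.OplaxMonoidal

universe v₀ v₁ v₂ v₃ v₄ u₀ u₁ u₂ u₃ u₄

variable {C : Type u₀} [Category.{v₀} C] {C₁ : Type u₁} [Category.{v₁} C₁]
  {C₂ : Type u₂} [Category.{v₂} C₂] {C₁₂ : Type u₃} [Category.{v₃} C₁₂]
  {T : Type u₄} [Category.{v₄} T]
  [MonoidalCategory C] [MonoidalCategory C₁] [MonoidalCategory C₂] [MonoidalCategory C₁₂]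
  [MonoidalCategory T]
  {R₁ : C ⥤ C₁} {R₂ : C ⥤ C₂} {Q₁ : C₁ ⥤ C₁₂} {Q₂ : C₂ ⥤ C₁₂}
  [R₁.Monoidal] [R₂.Monoidal] [Q₁.Monoidal] [Q₂.Monoidal]
  (σ : R₁ ⋙ Q₁ ≅ R₂ ⋙ Q₂) [NatTrans.IsMonoidal σ.hom] [(toTriples σ).IsEquivalence]
  {a : T ⥤ C₁} {b : T ⥤ C₂} [a.Monoidal] [b.Monoidal] (τ : a ⋙ Q₁ ≅ b ⋙ Q₂)
  [NatTrans.IsMonoidal τ.hom] {t : T ⥤ C} (i : t ⋙ R₁ ≅ a) (j : t ⋙ R₂ ≅ b)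
  (hw : ∀ x, Q₁.map (i.hom.app x) ≫ τ.hom.app x = σ.hom.app (t.obj x) ≫ Q₂.map (j.hom.app x))

include hw

/-- The structure morphisms of `t` are glued from those of `a` and `b`; these are compatible,
because `σ` and `τ` are monoidal. -/
lemma exists_liftsMonoidal : ∃ (e : 𝟙_ C ⟶ t.obj (𝟙_ T))
    (m : ∀ x y, t.obj x ⊗ t.obj y ⟶ t.obj (x ⊗ y)), LiftsMonoidal i e m ∧ LiftsMonoidal j e m := by
  have hw' (x : T) : Q₁.map (i.inv.app x) ≫ σ.hom.app (t.obj x) =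
      τ.hom.app x ≫ Q₂.map (j.inv.app x) := by
    rw [← cancel_epi (Q₁.map (i.hom.app x)), ← cancel_mono (Q₂.map (j.hom.app x))]
    simp only [Category.assoc, ← Q₁.map_comp_assoc, ← Q₂.map_comp, Iso.hom_inv_id_app,
      Iso.inv_hom_id_app, ← hw]
    simp [hw]
  have he : ∃ e : 𝟙_ C ⟶ t.obj (𝟙_ T), R₁.map e = η R₁ ≫ ε a ≫ i.inv.app (𝟙_ T) ∧
      R₂.map e = η R₂ ≫ ε b ≫ j.inv.app (𝟙_ T) := by
    apply exists_map_eq_of_full_toTriples σ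
    have h₁ := NatTrans.IsMonoidal.unit (τ := σ.hom)
    have h₂ := NatTrans.IsMonoidal.unit (τ := τ.hom)
    rw [comp_ε, comp_ε, Category.assoc] at h₁ h₂
    rw [← cancel_epi (ε Q₁ ≫ Q₁.map (ε R₁))]
    simp only [Category.assoc, Functor.map_comp, hw', reassoc_of% h₁]
    simp only [← Functor.map_comp_assoc, Functor.Monoidal.ε_η_assoc]
    simp only [reassoc_of% h₂]
  have hm (x y : T) : ∃ m : t.obj x ⊗ t.obj y ⟶ t.obj (x ⊗ y),
      R₁.map m = δ R₁ _ _ ≫ (i.hom.app x ⊗ₘ i.hom.app y) ≫ μ a x y ≫ i.inv.app (x ⊗ y) ∧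
      R₂.map m = δ R₂ _ _ ≫ (j.hom.app x ⊗ₘ j.hom.app y) ≫ μ b x y ≫ j.inv.app (x ⊗ y) := by
    apply exists_map_eq_of_full_toTriples σ
    have h₁ := NatTrans.IsMonoidal.tensor (τ := σ.hom) (t.obj x) (t.obj y)
    have h₂ := NatTrans.IsMonoidal.tensor (τ := τ.hom) x y
    rw [comp_μ, comp_μ, Category.assoc] at h₁ h₂
    rw [← cancel_epi (μ Q₁ _ _ ≫ Q₁.map (μ R₁ _ _))]
    simp only [Category.assoc, Functor.map_comp, hw', reassoc_of% h₁]
    simp only [← Functor.map_comp_assoc, Functor.Monoidal.μ_δ_assoc]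
    simp only [Functor.map_comp, Category.assoc, ← μ_natural_assoc, reassoc_of% h₂,
      MonoidalCategory.tensorHom_comp_tensorHom_assoc, hw]
  obtain ⟨e, he₁, he₂⟩ := he
  choose m hm₁ hm₂ using hm
  exact ⟨e, m, ⟨by simp [he₁], fun x y ↦ by simp [hm₁]⟩, ⟨by simp [he₂], fun x y ↦ by simp [hm₂]⟩⟩

/-- A functor which is glued from monoidal functors is monoidal. -/
lemma exists_monoidal : ∃ _ : t.Monoidal,
    NatTrans.IsMonoidal i.hom ∧ NatTrans.IsMonoidal j.hom := by
  obtain ⟨e, m, h₁, h₂⟩ := exists_liftsMonoidal σ τ i j hw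
  have he : IsIso e := by
    apply isIso_of_reflectsIsomorphisms_toTriples σ
    · have := h₁.unit
      rw [← IsIso.eq_inv_comp, ← IsIso.eq_comp_inv] at this
      rw [this]
      infer_instance
    · have := h₂.unit
      rw [← IsIso.eq_inv_comp, ← IsIso.eq_comp_inv] at this
      rw [this]
      infer_instance
  have hm (x y : T) : IsIso (m x y) := by
    apply isIso_of_reflectsIsomorphisms_toTriples σ
    · have := h₁.tensor x y
      rw [← IsIso.eq_inv_comp, ← IsIso.eq_comp_inv] at this
      rw [this]
      infer_instance
    · have := h₂.tensor x y
      rw [← IsIso.eq_inv_comp, ← IsIso.eq_comp_inv] at this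
      rw [this]
      infer_instance
  let M : t.CoreMonoidal :=
    { εIso := asIso e
      μIso := fun x y ↦ asIso (m x y)
      μIso_hom_natural_left := fun φ z ↦ hom_ext_of_faithful_toTriples σ
        (h₁.naturality_left φ z) (h₂.naturality_left φ z)
      μIso_hom_natural_right := fun z φ ↦ hom_ext_of_faithful_toTriples σ
        (h₁.naturality_right z φ) (h₂.naturality_right z φ)
      associativity := fun x y z ↦ hom_ext_of_faithful_toTriples σ
        (h₁.associativity x y z) (h₂.associativity x y z)
      left_unitality := fun x ↦ hom_ext_of_faithful_toTriples σ
        (h₁.left_unitality x) (h₂.left_unitality x)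
      right_unitality := fun x ↦ hom_ext_of_faithful_toTriples σ
        (h₁.right_unitality x) (h₂.right_unitality x) }
  let := M.toMonoidal
  exact ⟨this, ⟨(Category.assoc _ _ _).trans h₁.unit,
      fun x y ↦ (Category.assoc _ _ _).trans (h₁.tensor x y)⟩,
    ⟨(Category.assoc _ _ _).trans h₂.unit,
      fun x y ↦ (Category.assoc _ _ _).trans (h₂.tensor x y)⟩⟩

end GluingFunctors

section Braided

open Functor.LaxMonoidal

lemma LiftsMonoidal.of_isMonoidal {C D T : Type*} [Category* C] [Category* D] [Category* T]
    [MonoidalCategory C] [MonoidalCategory D] [MonoidalCategory T] {t : T ⥤ C} [t.Monoidal]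
    {R : C ⥤ D} [R.Monoidal] {a : T ⥤ D} [a.Monoidal] (i : t ⋙ R ≅ a)
    [NatTrans.IsMonoidal i.hom] : LiftsMonoidal i (ε t) (μ t) where
  unit := by simpa using NatTrans.IsMonoidal.unit (τ := i.hom)
  tensor x y := by simpa using NatTrans.IsMonoidal.tensor (τ := i.hom) x y

lemma map_braiding_of_toTriples {C C₁ C₂ C₁₂ T : Type*} [Category* C] [Category* C₁]
    [Category* C₂] [Category* C₁₂] [Category* T] [MonoidalCategory C] [MonoidalCategory C₁]
    [MonoidalCategory C₂] [MonoidalCategory T] [BraidedCategory C] [BraidedCategory C₁]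
    [BraidedCategory C₂] [BraidedCategory T] {R₁ : C ⥤ C₁} {R₂ : C ⥤ C₂} {Q₁ : C₁ ⥤ C₁₂}
    {Q₂ : C₂ ⥤ C₁₂} [R₁.Braided] [R₂.Braided] (σ : R₁ ⋙ Q₁ ≅ R₂ ⋙ Q₂) [(toTriples σ).Faithful]
    {a : T ⥤ C₁} {b : T ⥤ C₂} [a.Braided] [b.Braided] {t : T ⥤ C} [t.Monoidal]
    (i : t ⋙ R₁ ≅ a) [NatTrans.IsMonoidal i.hom] (j : t ⋙ R₂ ≅ b) [NatTrans.IsMonoidal j.hom]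
    (x y : T) : μ t x y ≫ t.map (β_ x y).hom = (β_ (t.obj x) (t.obj y)).hom ≫ μ t y x :=
  hom_ext_of_faithful_toTriples σ ((LiftsMonoidal.of_isMonoidal i).braided x y)
    ((LiftsMonoidal.of_isMonoidal j).braided x y)

end Braided

section Colimits

variable {C C₁ C₂ C₁₂ T : Type u} [Category.{v} C] [Category.{v} C₁] [Category.{v} C₂]
  [Category.{v} C₁₂] [Category.{v} T] {R₁ : C ⥤ C₁} {R₂ : C ⥤ C₂} {Q₁ : C₁ ⥤ C₁₂}
  {Q₂ : C₂ ⥤ C₁₂}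

/-- Whether the canonical comparison map of colimits is invertible may be tested on both
components. -/
lemma preservesColimits_of_toTriples [HasColimits C] [HasColimits T] [PreservesColimits R₁]
    [PreservesColimits R₂] (σ : R₁ ⋙ Q₁ ≅ R₂ ⋙ Q₂) [(toTriples σ).ReflectsIsomorphisms] {t : T ⥤ C}
    (h₁ : PreservesColimits (t ⋙ R₁)) (h₂ : PreservesColimits (t ⋙ R₂)) : PreservesColimits t where
  preservesColimitsOfShape {J _} :=
    { preservesColimit := fun {K} ↦ by
        have key {D : Type u} [Category.{v} D] (R : C ⥤ D) [PreservesColimits R]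
            (h : PreservesColimits (t ⋙ R)) : IsIso (R.map (colimit.post K t)) := by
          have : HasColimit ((K ⋙ t) ⋙ R) := ⟨⟨_, isColimitOfPreserves R (colimit.isColimit _)⟩⟩
          have : HasColimit (K ⋙ t ⋙ R) := this
          have h₃ := colimit.post_post K t R
          have : IsIso (colimit.post (K ⋙ t) R ≫ R.map (colimit.post K t)) := by
            rw [h₃]
            exact inferInstanceAs (IsIso (colimit.post K (t ⋙ R)))
          exact IsIso.of_isIso_comp_left (colimit.post (K ⋙ t) R) _
        have := isIso_of_reflectsIsomorphisms_toTriples σ (colimit.post K t) (key R₁ h₁) (key R₂ h₂)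
        exact preservesColimit_of_isIso_post t K }

end Colimits

/-! ### Bicategorical pullbacks of tensor categories -/

section

open Functor.LaxMonoidal Functor.OplaxMonoidal

variable {C D T : Type*} [Category* C] [Category* D] [Category* T] [MonoidalCategory C]
  [MonoidalCategory D] [MonoidalCategory T] {s t : T ⥤ C} [s.Monoidal] [t.Monoidal] {R : C ⥤ D}
  [R.Monoidal] (η : s ⟶ t) [NatTrans.IsMonoidal (Functor.whiskerRight η R)]

lemma map_ε_comp_app : R.map (ε s ≫ η.app (𝟙_ T)) = R.map (ε t) := by
  have h := NatTrans.IsMonoidal.unit (τ := Functor.whiskerRight η R)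
  rw [comp_ε, comp_ε, Category.assoc, cancel_epi] at h
  rwa [R.map_comp]

lemma map_μ_comp_app (x y : T) :
    R.map (μ s x y ≫ η.app (x ⊗ y)) = R.map ((η.app x ⊗ₘ η.app y) ≫ μ t x y) := by
  have h := NatTrans.IsMonoidal.tensor (τ := Functor.whiskerRight η R) x y
  rw [comp_μ, comp_μ] at h
  simp only [Functor.whiskerRight_app] at h
  rw [μ_natural_assoc,
    Category.assoc, cancel_epi] at h
  rwa [R.map_comp, R.map_comp]

end

namespace CocompleteTensorCat

variable {P X Y Z : CocompleteTensorCat.{v, u}} {f : P ⟶ X} {g : P ⟶ Y} {h : X ⟶ Z} {k : Y ⟶ Z}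

/-- The underlying square of functors of a square of tensor functors. -/
def underlyingSquare (σ : f ≫ h ≅ g ≫ k) : f.functor ⋙ h.functor ≅ g.functor ⋙ k.functor :=
  (forget P Z).mapIso σ

variable (σ : f ≫ h ≅ g ≫ k) [(toTriples (underlyingSquare σ)).IsEquivalence]

instance : NatTrans.IsMonoidal (underlyingSquare σ).hom := σ.hom.isMonoidal

/-- If `P` is the category of triples on the level of underlying categories, then tensor functors
to `P` are triples of tensor functors. -/
lemma exists_hom_of_toTriples {T : CocompleteTensorCat.{v, u}} (a : T ⟶ X) (b : T ⟶ Y)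
    (τ : a ≫ h ≅ b ≫ k) : ∃ (t : T ⟶ P) (i : t ≫ f ≅ a) (j : t ≫ g ≅ b), ∀ x : T,
      h.functor.map (i.hom.natTrans.app x) ≫ τ.hom.natTrans.app x =
        σ.hom.natTrans.app (t.functor.obj x) ≫ k.functor.map (j.hom.natTrans.app x) := by
  have hτ : NatTrans.IsMonoidal (underlyingSquare τ).hom := inferInstance
  obtain ⟨t, i, j, hw⟩ := exists_functor_of_isEquivalence_toTriples (underlyingSquare σ)
    a.functor b.functor (underlyingSquare τ)
  obtain ⟨_, hi, hj⟩ := exists_monoidal (underlyingSquare σ) (underlyingSquare τ) i j hw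
  let _ : t.Braided := { braided := map_braiding_of_toTriples (underlyingSquare σ) i j }
  have : PreservesColimits t := preservesColimits_of_toTriples (underlyingSquare σ)
    (preservesColimits_of_natIso i.symm) (preservesColimits_of_natIso j.symm)
  let t' : T ⟶ P := { functor := t }
  exact ⟨t', isoMk (F := t' ≫ f) (G := a) i hi, isoMk (F := t' ≫ g) (G := b) j hj, hw⟩

/-- Compatible morphisms of tensor functors on both components glue; monoidality of the result may
be tested on both components. -/
lemma exists_whiskerRight_eq_of_toTriples {T : CocompleteTensorCat.{v, u}} {s t : T ⟶ P}
    (a : s ≫ f ⟶ t ≫ f) (b : s ≫ g ⟶ t ≫ g) (hw : ∀ x : T,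
      h.functor.map (a.natTrans.app x) ≫ σ.hom.natTrans.app (t.functor.obj x) =
        σ.hom.natTrans.app (s.functor.obj x) ≫ k.functor.map (b.natTrans.app x)) :
    ∃ φ : s ⟶ t, whiskerRight φ f = a ∧ whiskerRight φ g = b := by
  have hφ (x : T) : ∃ φ : s.functor.obj x ⟶ t.functor.obj x,
      f.functor.map φ = a.natTrans.app x ∧ g.functor.map φ = b.natTrans.app x :=
    exists_map_eq_of_full_toTriples (underlyingSquare σ) _ _ (hw x)
  choose φ h₁ h₂ using hφ
  have key {M N : P} {φ ψ : M ⟶ N} := hom_ext_of_faithful_toTriples (underlyingSquare σ)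
    (M := M) (N := N) (φ := φ) (ψ := ψ)
  let η : s.functor ⟶ t.functor :=
    { app := φ
      naturality := fun x y p ↦ by
        apply key
        · simpa [h₁] using a.natTrans.naturality p
        · simpa [h₂] using b.natTrans.naturality p }
  have ha : Functor.whiskerRight η f.functor = a.natTrans := by
    ext x
    exact h₁ x
  have hb : Functor.whiskerRight η g.functor = b.natTrans := by
    ext x
    exact h₂ x
  have hf : NatTrans.IsMonoidal (Functor.whiskerRight η f.functor) := ha ▸ a.isMonoidal
  have hg : NatTrans.IsMonoidal (Functor.whiskerRight η g.functor) := hb ▸ b.isMonoidal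
  have hη : NatTrans.IsMonoidal η :=
    { unit := key (map_ε_comp_app (R := f.functor) η) (map_ε_comp_app (R := g.functor) η)
      tensor := fun x y ↦
        key (map_μ_comp_app (R := f.functor) η x y) (map_μ_comp_app (R := g.functor) η x y) }
  exact ⟨{ natTrans := η }, hom₂_ext ha, hom₂_ext hb⟩

include σ in
lemma whiskerRight_ext_of_toTriples {T : CocompleteTensorCat.{v, u}} {s t : T ⟶ P} {φ ψ : s ⟶ t}
    (h₁ : whiskerRight φ f = whiskerRight ψ f) (h₂ : whiskerRight φ g = whiskerRight ψ g) :
    φ = ψ := by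
  apply hom₂_ext
  ext x
  exact hom_ext_of_faithful_toTriples (underlyingSquare σ)
    (NatTrans.congr_app (congr_arg Hom₂.natTrans h₁) x)
    (NatTrans.congr_app (congr_arg Hom₂.natTrans h₂) x)

/-- A square of tensor functors is a bicategorical pullback if it is so on the level of the
underlying categories. -/
theorem isBicategoricalPullback_of_toTriples : IsBicategoricalPullback σ := fun T ↦
  { faithful := ⟨fun {s t φ ψ} hφ ↦ whiskerRight_ext_of_toTriples σ
      (congr_arg CategoricalPullback.Hom.fst hφ) (congr_arg CategoricalPullback.Hom.snd hφ)⟩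
    full := ⟨fun {s t} p ↦ by
      obtain ⟨p₁, p₂, w⟩ := p
      obtain ⟨φ, h₁, h₂⟩ := exists_whiskerRight_eq_of_toTriples σ p₁ p₂ fun x ↦ by
        have := NatTrans.congr_app (congr_arg Hom₂.natTrans w) x
        change _ ≫ 𝟙 _ ≫ σ.hom.natTrans.app _ ≫ 𝟙 _ =
          (𝟙 _ ≫ σ.hom.natTrans.app _ ≫ 𝟙 _) ≫ _ at this
        rwa [Category.id_comp, Category.comp_id, Category.id_comp, Category.comp_id] at this
      exact ⟨φ, CategoricalPullback.hom_ext h₁ h₂⟩⟩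
    essSurj := ⟨fun p ↦ by
      obtain ⟨a, b, τ⟩ := p
      obtain ⟨t, i, j, hw⟩ := exists_hom_of_toTriples σ a b τ
      refine ⟨t, ⟨CategoricalPullback.mkIso i j (hom₂_ext ?_)⟩⟩
      ext x
      change _ = (𝟙 _ ≫ σ.hom.natTrans.app _ ≫ 𝟙 _) ≫ _
      rw [Category.id_comp, Category.comp_id]
      exact hw x⟩ }

end CocompleteTensorCat

/-! ### Linear localizations and pullbacks -/

section Linear

variable {C L D : Type*} [Category* C] [Category* L] [Category* D] [Preadditive C] [Preadditive L]
  [Preadditive D] {R : C ⥤ L} {ι : L ⥤ C} (adj : R ⊣ ι)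

/-- A functor out of a reflective subcategory is determined by its composition with the
reflector. -/
noncomputable def reflectorCompIso {C L D : Type*} [Category* C] [Category* L] [Category* D]
    {R : C ⥤ L} {ι : L ⥤ C} (adj : R ⊣ ι) [ι.Full] [ι.Faithful] {F : C ⥤ D} {G : L ⥤ D}
    (i : R ⋙ G ≅ F) : ι ⋙ F ≅ G :=
  Functor.isoWhiskerLeft ι i.symm ≪≫ (Functor.associator ι R G).symm ≪≫
    Functor.isoWhiskerRight (asIso adj.counit) G ≪≫ G.leftUnitor

include adj

lemma additive_of_reflector_comp [R.Additive] [ι.Full] [ι.Faithful] {F : C ⥤ D} {G : L ⥤ D}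
    (i : R ⋙ G ≅ F) [F.Additive] : G.Additive :=
  have := adj.right_adjoint_additive
  Functor.additive_of_iso (reflectorCompIso adj i)

variable (K : Type*) [Ring K] [Linear K C] [Linear K L] [Linear K D]

lemma linear_of_leftAdjoint [ι.Linear K] : R.Linear K where
  map_smul f r := (adj.homEquiv _ _).injective (by simp [Adjunction.homEquiv_unit])

lemma linear_of_rightAdjoint [R.Linear K] : ι.Linear K where
  map_smul f r := (adj.homEquiv _ _).symm.injective (by simp [Adjunction.homEquiv_counit])

lemma linear_of_reflector_comp [R.Linear K] [ι.Full] [ι.Faithful] {F : C ⥤ D} {G : L ⥤ D}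
    (i : R ⋙ G ≅ F) [F.Linear K] : G.Linear K :=
  have := linear_of_rightAdjoint adj K
  Functor.linear_of_iso K (reflectorCompIso adj i)

end Linear

lemma additive_of_toTriples {C C₁ C₂ C₁₂ T : Type*} [Category* C] [Category* C₁] [Category* C₂]
    [Category* C₁₂] [Category* T] [Preadditive C] [Preadditive C₁] [Preadditive C₂] [Preadditive T]
    {R₁ : C ⥤ C₁} {R₂ : C ⥤ C₂} {Q₁ : C₁ ⥤ C₁₂} {Q₂ : C₂ ⥤ C₁₂} [R₁.Additive] [R₂.Additive]
    (σ : R₁ ⋙ Q₁ ≅ R₂ ⋙ Q₂) [(toTriples σ).Faithful] {t : T ⥤ C} (h₁ : (t ⋙ R₁).Additive)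
    (h₂ : (t ⋙ R₂).Additive) : t.Additive where
  map_add {x y φ ψ} := by
    apply hom_ext_of_faithful_toTriples σ
    · simpa using (t ⋙ R₁).map_add (f := φ) (g := ψ)
    · simpa using (t ⋙ R₂).map_add (f := φ) (g := ψ)

lemma linear_of_toTriples {C C₁ C₂ C₁₂ T : Type*} [Category* C] [Category* C₁] [Category* C₂]
    [Category* C₁₂] [Category* T] [Preadditive C] [Preadditive C₁] [Preadditive C₂] [Preadditive T]
    (K : Type*) [Ring K] [Linear K C] [Linear K C₁] [Linear K C₂] [Linear K T]
    {R₁ : C ⥤ C₁} {R₂ : C ⥤ C₂} {Q₁ : C₁ ⥤ C₁₂} {Q₂ : C₂ ⥤ C₁₂} [R₁.Linear K] [R₂.Linear K]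
    (σ : R₁ ⋙ Q₁ ≅ R₂ ⋙ Q₂) [(toTriples σ).Faithful] {t : T ⥤ C} (h₁ : (t ⋙ R₁).Linear K)
    (h₂ : (t ⋙ R₂).Linear K) : t.Linear K where
  map_smul {x y} φ r := by
    apply hom_ext_of_faithful_toTriples σ
    · simpa using (t ⋙ R₁).map_smul r φ
    · simpa using (t ⋙ R₂).map_smul r φ

namespace LinearCocompleteTensorCat

variable {K : Type w} [CommRing K]

section Pullback

variable {P X Y Z : LinearCocompleteTensorCat.{w, v, u} K} {f : P ⟶ X} {g : P ⟶ Y} {h : X ⟶ Z}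
  {k : Y ⟶ Z}

/-- The underlying square of tensor functors of a square of linear tensor functors. -/
def toTensorSquare (σ : f ≫ h ≅ g ≫ k) : f.toTensor ≫ h.toTensor ≅ g.toTensor ≫ k.toTensor :=
  (forget P Z).mapIso σ

/-- A square of linear tensor functors is a bicategorical pullback if it is so on the level of the
underlying categories. -/
theorem isBicategoricalPullback_of_toTriples (σ : f ≫ h ≅ g ≫ k)
    [(toTriples (CocompleteTensorCat.underlyingSquare (toTensorSquare σ))).IsEquivalence] :
    IsBicategoricalPullback σ := fun T ↦
  { faithful := ⟨fun {s t φ ψ} hφ ↦ hom₂_ext <|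
      CocompleteTensorCat.whiskerRight_ext_of_toTriples (toTensorSquare σ)
        (congr_arg (fun p ↦ Hom₂.toTensor (CategoricalPullback.Hom.fst p)) hφ)
        (congr_arg (fun p ↦ Hom₂.toTensor (CategoricalPullback.Hom.snd p)) hφ)⟩
    full := ⟨fun {s t} p ↦ by
      obtain ⟨p₁, p₂, w⟩ := p
      obtain ⟨φ, h₁, h₂⟩ := CocompleteTensorCat.exists_whiskerRight_eq_of_toTriples
        (toTensorSquare σ) p₁.toTensor p₂.toTensor fun x ↦ by
          have := NatTrans.congr_app (congr_arg (fun q ↦ q.toTensor.natTrans) w) x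
          change _ ≫ 𝟙 _ ≫ σ.hom.toTensor.natTrans.app _ ≫ 𝟙 _ =
            (𝟙 _ ≫ σ.hom.toTensor.natTrans.app _ ≫ 𝟙 _) ≫ _ at this
          rwa [Category.id_comp, Category.comp_id, Category.id_comp, Category.comp_id] at this
      exact ⟨⟨φ⟩, CategoricalPullback.hom_ext (hom₂_ext h₁) (hom₂_ext h₂)⟩⟩
    essSurj := ⟨fun p ↦ by
      obtain ⟨a, b, τ⟩ := p
      obtain ⟨t, i, j, hw⟩ := CocompleteTensorCat.exists_hom_of_toTriples (toTensorSquare σ)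
        a.toTensor b.toTensor (toTensorSquare τ)
      let i' : t.functor ⋙ f.toTensor.functor ≅ a.toTensor.functor :=
        (CocompleteTensorCat.forget _ _).mapIso i
      let j' : t.functor ⋙ g.toTensor.functor ≅ b.toTensor.functor :=
        (CocompleteTensorCat.forget _ _).mapIso j
      have : t.functor.Additive := additive_of_toTriples
        (CocompleteTensorCat.underlyingSquare (toTensorSquare σ))
        (Functor.additive_of_iso i'.symm) (Functor.additive_of_iso j'.symm)
      have : t.functor.Linear K := linear_of_toTriples K
        (CocompleteTensorCat.underlyingSquare (toTensorSquare σ))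
        (Functor.linear_of_iso K i'.symm) (Functor.linear_of_iso K j'.symm)
      let t' : T ⟶ P := { toTensor := t }
      refine ⟨t', ⟨CategoricalPullback.mkIso (isoMk (F := t' ≫ f) (G := a) i)
        (isoMk (F := t' ≫ g) (G := b) j) (hom₂_ext (CocompleteTensorCat.hom₂_ext ?_))⟩⟩
      ext x
      change _ = (𝟙 _ ≫ σ.hom.toTensor.natTrans.app _ ≫ 𝟙 _) ≫ _
      rw [Category.id_comp, Category.comp_id]
      exact hw x⟩ }

end Pullback

/-- A linear reflector is a localization among linear tensor functors if it is one among all tensor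
functors. -/
lemma isLocalizationAt_of_toTensor {C L : LinearCocompleteTensorCat.{w, v, u} K} {R : C ⟶ L}
    {E : WellCopointed C} (hR : E.IsReflector R.toTensor.functor) {I J : C} {e : I ⟶ J}
    (h : IsLocalizationAt (CocompleteTensorCat.Inverts e) R.toTensor) :
    IsLocalizationAt (Inverts e) R where
  mem := h.mem
  exists_lift D F hF := by
    obtain ⟨ι, adj, _, _, -⟩ := hR.exists_rightAdjoint
    obtain ⟨G, ⟨i⟩⟩ := h.exists_lift F.toTensor hF
    let i' : R.toTensor.functor ⋙ G.functor ≅ F.toTensor.functor :=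
      (CocompleteTensorCat.forget _ _).mapIso i
    have : G.functor.Additive := additive_of_reflector_comp adj i'
    have : G.functor.Linear K := linear_of_reflector_comp adj K i'
    let G' : L ⟶ D := { toTensor := G }
    exact ⟨G', ⟨isoMk (F := R ≫ G') (G := F) i⟩⟩
  existsUnique_lift D G H θ := by
    obtain ⟨η, hη, hu⟩ := h.existsUnique_lift G.toTensor H.toTensor θ.toTensor
    exact ⟨⟨η⟩, hom₂_ext hη, fun ζ hζ ↦ hom₂_ext (hu ζ.toTensor (congr_arg Hom₂.toTensor hζ))⟩

end LinearCocompleteTensorCat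

namespace WellCopointed

variable {K : Type w} [CommRing K] {C : LinearCocompleteTensorCat.{w, v, u} K}
  [IsLocallyFinitelyPresentable.{v} C] (E : WellCopointed C) [E.LocallyBijective.IsMonoidal]

noncomputable instance : Preadditive E.localization :=
  Preadditive.fullSubcategory E.IsLocal

noncomputable instance : Linear K E.localization :=
  Linear.fullSubcategory E.IsLocal

instance : E.toLocalization.functor.Additive :=
  E.reflectorAdj.left_adjoint_additive

instance : E.toLocalization.functor.Linear K :=
  linear_of_leftAdjoint E.reflectorAdj K

/-- The functors `A ⊗ -` on the category of local objects are induced by functors `X ⊗ -` on `C`,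
from which they inherit additivity and linearity. -/
lemma exists_reflector_comp_tensorLeft_iso (A : E.localization) :
    ∃ (X : C) (G : E.localization ⥤ E.localization), Nonempty (G ≅ tensorLeft A) ∧
      Nonempty (E.toLocalization.functor ⋙ G ≅ tensorLeft X ⋙ E.toLocalization.functor) := by
  have : E.toLocalization.functor.EssSurj :=
    Localization.essSurj E.reflector E.LocallyBijective
  exact ⟨E.toLocalization.functor.objPreimage A, _,
    ⟨(curriedTensor E.localization).mapIso (E.toLocalization.functor.objObjPreimageIso A)⟩,
    ⟨Functor.Monoidal.commTensorLeft E.toLocalization.functor _⟩⟩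

lemma additive_tensorLeft (A : E.localization) : (tensorLeft A).Additive := by
  obtain ⟨ι, adj, _, _, -⟩ := E.isReflector_toLocalization.exists_rightAdjoint
  obtain ⟨X, G, ⟨i⟩, ⟨j⟩⟩ := E.exists_reflector_comp_tensorLeft_iso A
  have := additive_of_reflector_comp adj j
  exact Functor.additive_of_iso i

lemma linear_tensorLeft (A : E.localization) : (tensorLeft A).Linear K := by
  obtain ⟨ι, adj, _, _, -⟩ := E.isReflector_toLocalization.exists_rightAdjoint
  obtain ⟨X, G, ⟨i⟩, ⟨j⟩⟩ := E.exists_reflector_comp_tensorLeft_iso A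
  have := linear_of_reflector_comp adj K j
  exact Functor.linear_of_iso K i

instance : MonoidalPreadditive E.localization := by
  have h₁ := E.additive_tensorLeft
  have h₂ (A : E.localization) : (tensorRight A).Additive :=
    Functor.additive_of_iso (BraidedCategory.tensorLeftIsoTensorRight A)
  exact
    { whiskerLeft_zero := fun {A _ _} ↦ (tensorLeft A).map_zero _ _
      zero_whiskerRight := fun {A _ _} ↦ (tensorRight A).map_zero _ _
      whiskerLeft_add := fun {A _ _} _ _ ↦ (tensorLeft A).map_add
      add_whiskerRight := fun {A _ _} _ _ ↦ (tensorRight A).map_add }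

instance : MonoidalLinear K E.localization := by
  have h₁ := E.linear_tensorLeft
  have h₂ (A : E.localization) : (tensorRight A).Linear K :=
    Functor.linear_of_iso K (BraidedCategory.tensorLeftIsoTensorRight A)
  exact
    { whiskerLeft_smul := fun A _ _ r φ ↦ (tensorLeft A).map_smul r φ
      smul_whiskerRight := fun r _ _ φ A ↦ (tensorRight A).map_smul r φ }

/-- The category of local objects as a linear tensor category. -/
noncomputable def linearLocalization : LinearCocompleteTensorCat.{w, v, u} K where
  toTensorCat := E.localization

/-- The linear localization functor. -/
noncomputable def toLinearLocalization : C ⟶ E.linearLocalization where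
  toTensor := E.toLocalization
  additive := inferInstanceAs E.toLocalization.functor.Additive
  linear := inferInstanceAs (E.toLocalization.functor.Linear K)

end WellCopointed

/-! ### Localizations at idals -/

open WellCopointed

section

variable {C : CocompleteTensorCat.{v, u}} (hC : IsLocallyFinitelyPresentableTensor C) {I J : C}
  (hI : IsFinitelyPresentable.{v} I) (hJ : IsFinitelyPresentable.{v} J)
  {e : I ⟶ 𝟙_ C} {f : J ⟶ 𝟙_ C}

/-- The reflector onto the local objects is a localization at `e`. -/
lemma exists_isLocalizationAt_inverts (he : IsIdal e) :
    ∃ (L : CocompleteTensorCat.{v, u}) (R : C ⟶ L),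
      IsLocalizationAt (CocompleteTensorCat.Inverts e) R ∧
        (ofIdal hC hI he).IsReflector R.functor := by
  have := hC.isLocallyFinitelyPresentable
  have := isMonoidal_locallyBijective_ofIdal hC hI he
  have h := (ofIdal hC hI he).isReflector_toLocalization
  exact ⟨_, (ofIdal hC hI he).toLocalization, isLocalizationAt_toLocalization _ _
    (isIso_map_of_isReflector_ofIdal hC hI he h) fun D F hF ↦ isIso_map_ε_ofIdal hC hI he F hF, h⟩

lemma isReflector_of_isLocalizationAt_inverts (he : IsIdal e) {L : CocompleteTensorCat.{v, u}}
    {R : C ⟶ L} (hR : IsLocalizationAt (CocompleteTensorCat.Inverts e) R) :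
    (ofIdal hC hI he).IsReflector R.functor := by
  obtain ⟨L', R', h₁, h₂⟩ := exists_isLocalizationAt_inverts hC hI he
  exact h₂.of_isLocalizationAt h₁ hR

variable (h : IsIdalCover e f)

include h hI hJ

lemma gluesObjects_of_isIdalCover {C₁ C₂ C₁₂ : Type*} [Category* C₁] [Category* C₂] [Category* C₁₂]
    {R₁ : C ⥤ C₁} {R₂ : C ⥤ C₂} {R₁₂ : C ⥤ C₁₂} {Q₁ : C₁ ⥤ C₁₂} {Q₂ : C₂ ⥤ C₁₂}
    (h₁ : (ofIdal hC hI h.isIdal_left).IsReflector R₁)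
    (h₂ : (ofIdal hC hJ h.isIdal_right).IsReflector R₂)
    (h₁₂ : (ofIdal hC (hC.tensor I J hI hJ)
      (isIdal_idalProd h.isIdal_left h.isIdal_right)).IsReflector R₁₂)
    (i₁ : R₁ ⋙ Q₁ ≅ R₁₂) (i₂ : R₂ ⋙ Q₂ ≅ R₁₂) : GluesObjects i₁ i₂ := by
  have := hC.isLocallyFinitelyPresentable
  exact gluesObjects (ofIdal_isCover hC hI hJ h.isIdal_left h.isIdal_right h)
    (ofIdal_commutes hC hI hJ h.isIdal_left h.isIdal_right)
    (ofIdal_commutes hC hJ hI h.isIdal_right h.isIdal_left)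
    (fun Z ↦ isLocal_ofIdal_idalProd hC hI hJ h.isIdal_left h.isIdal_right (hC.tensor I J hI hJ))
    h₁ h₂ h₁₂ i₁ i₂

include hC

/-- The localization at `e ⊗ f` inverts both `e` and `f`. -/
lemma nonempty_localizationSquare : Nonempty (LocalizationSquare C (CocompleteTensorCat.Inverts e)
    (CocompleteTensorCat.Inverts f) (CocompleteTensorCat.Inverts (idalProd e f))) := by
  obtain ⟨L₁, R₁, h₁, -⟩ := exists_isLocalizationAt_inverts hC hI h.isIdal_left
  obtain ⟨L₂, R₂, h₂, -⟩ := exists_isLocalizationAt_inverts hC hJ h.isIdal_right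
  obtain ⟨L₁₂, R₁₂, h₁₂, -⟩ := exists_isLocalizationAt_inverts hC (hC.tensor I J hI hJ)
    (isIdal_idalProd h.isIdal_left h.isIdal_right)
  have := isIso_map_of_isIso_map_idalProd R₁₂.functor h.isIdal_left h.isIdal_right h₁₂.mem
  exact LocalizationSquare.nonempty_of_isLocalizationAt h₁ h₂ h₁₂ this.1 this.2

/-- The functors of an arbitrary square of localizations are reflectors onto the local objects, so
objects glue; morphisms of tensor functors and tensor structures then glue as well. -/
theorem isBicategoricalPullback_and_gluesObjects
    (S : LocalizationSquare C (CocompleteTensorCat.Inverts e)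
      (CocompleteTensorCat.Inverts f) (CocompleteTensorCat.Inverts (idalProd e f))) :
    IsBicategoricalPullback S.iso ∧ GluesObjects (CocompleteTensorCat.underlyingIso S.iso₁)
      (CocompleteTensorCat.underlyingIso S.iso₂) := by
  have hG : GluesObjects (CocompleteTensorCat.underlyingIso S.iso₁)
      (CocompleteTensorCat.underlyingIso S.iso₂) :=
    gluesObjects_of_isIdalCover hC hI hJ h
      (isReflector_of_isLocalizationAt_inverts hC hI _ S.isLocalization₁)
      (isReflector_of_isLocalizationAt_inverts hC hJ _ S.isLocalization₂)
      (isReflector_of_isLocalizationAt_inverts hC _ _ S.isLocalization₁₂) _ _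
  have : (toTriples (CocompleteTensorCat.underlyingSquare S.iso)).IsEquivalence :=
    hG.isEquivalence
  exact ⟨CocompleteTensorCat.isBicategoricalPullback_of_toTriples S.iso, hG⟩

end

namespace LinearCocompleteTensorCat

variable {K : Type w} [CommRing K] {C : LinearCocompleteTensorCat.{w, v, u} K}
  (hC : IsLocallyFinitelyPresentableTensor C) {I J : C}
  (hI : IsFinitelyPresentable.{v} I) (hJ : IsFinitelyPresentable.{v} J)
  {e : I ⟶ 𝟙_ C} {f : J ⟶ 𝟙_ C}

/-- The reflector onto the local objects is a localization at `e` among linear tensor functors. -/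
lemma exists_isLocalizationAt_inverts (he : IsIdal e) :
    ∃ (L : LinearCocompleteTensorCat.{w, v, u} K) (R : C ⟶ L),
      IsLocalizationAt (Inverts e) R ∧ (ofIdal hC hI he).IsReflector R.toTensor.functor := by
  have := hC.isLocallyFinitelyPresentable
  have := isMonoidal_locallyBijective_ofIdal hC hI he
  have h := (ofIdal hC hI he).isReflector_toLocalization
  have h' : IsLocalizationAt (CocompleteTensorCat.Inverts e) (ofIdal hC hI he).toLocalization :=
    isLocalizationAt_toLocalization _ _
      (isIso_map_of_isReflector_ofIdal hC hI he h) fun D F hF ↦ isIso_map_ε_ofIdal hC hI he F hF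
  have h'' : (ofIdal hC hI he).IsReflector
      (ofIdal hC hI he).toLinearLocalization.toTensor.functor := h
  exact ⟨_, (ofIdal hC hI he).toLinearLocalization, isLocalizationAt_of_toTensor h'' h', h''⟩

lemma isReflector_of_isLocalizationAt_inverts (he : IsIdal e)
    {L : LinearCocompleteTensorCat.{w, v, u} K} {R : C ⟶ L}
    (hR : IsLocalizationAt (Inverts e) R) : (ofIdal hC hI he).IsReflector R.toTensor.functor := by
  obtain ⟨L', R', h₁, h₂⟩ := exists_isLocalizationAt_inverts hC hI he
  exact h₂.of_isLocalizationAt_linear h₁ hR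

variable (h : IsIdalCover e f)

include hC h hI hJ

/-- The localization at `e ⊗ f` inverts both `e` and `f`. -/
lemma nonempty_localizationSquare :
    Nonempty (LocalizationSquare C (Inverts e) (Inverts f) (Inverts (idalProd e f))) := by
  obtain ⟨L₁, R₁, h₁, -⟩ := exists_isLocalizationAt_inverts hC hI h.isIdal_left
  obtain ⟨L₂, R₂, h₂, -⟩ := exists_isLocalizationAt_inverts hC hJ h.isIdal_right
  obtain ⟨L₁₂, R₁₂, h₁₂, -⟩ := exists_isLocalizationAt_inverts hC (hC.tensor I J hI hJ)
    (isIdal_idalProd h.isIdal_left h.isIdal_right)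
  have := isIso_map_of_isIso_map_idalProd R₁₂.toTensor.functor h.isIdal_left h.isIdal_right
    h₁₂.mem
  exact LocalizationSquare.nonempty_of_isLocalizationAt h₁ h₂ h₁₂ this.1 this.2

/-- The linear analogue: gluing of objects concerns the underlying categories only, and linearity of
a glued functor may be tested on both components. -/
theorem isBicategoricalPullback_and_gluesObjects
    (S : LocalizationSquare C (Inverts e) (Inverts f) (Inverts (idalProd e f))) :
    IsBicategoricalPullback S.iso ∧ GluesObjects (underlyingIso S.iso₁)
      (underlyingIso S.iso₂) := by
  have hG : GluesObjects (underlyingIso S.iso₁) (underlyingIso S.iso₂) :=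
    gluesObjects_of_isIdalCover hC hI hJ h
      (isReflector_of_isLocalizationAt_inverts hC hI _ S.isLocalization₁)
      (isReflector_of_isLocalizationAt_inverts hC hJ _ S.isLocalization₂)
      (isReflector_of_isLocalizationAt_inverts hC _ _ S.isLocalization₁₂) _ _
  have : (toTriples
      (CocompleteTensorCat.underlyingSquare (toTensorSquare S.iso))).IsEquivalence :=
    hG.isEquivalence
  exact ⟨isBicategoricalPullback_of_toTriples S.iso, hG⟩

end LinearCocompleteTensorCat

end IdalGluing

theorem mainTheorem4 :
    (∀ (C : CocompleteTensorCat.{v, u}), IsLocallyFinitelyPresentableTensor C →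
      ∀ (I J : C), IsFinitelyPresentable.{v} I → IsFinitelyPresentable.{v} J →
      ∀ (e : I ⟶ 𝟙_ C) (f : J ⟶ 𝟙_ C), IsIdalCover e f →
        Nonempty (LocalizationSquare C (CocompleteTensorCat.Inverts e)
          (CocompleteTensorCat.Inverts f) (CocompleteTensorCat.Inverts (idalProd e f))) ∧
        ∀ S : LocalizationSquare C (CocompleteTensorCat.Inverts e)
          (CocompleteTensorCat.Inverts f) (CocompleteTensorCat.Inverts (idalProd e f)),
          IsBicategoricalPullback S.iso ∧
          GluesObjects (CocompleteTensorCat.underlyingIso S.iso₁)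
            (CocompleteTensorCat.underlyingIso S.iso₂)) ∧
    (∀ (K : Type w) [CommRing K] (C : LinearCocompleteTensorCat.{w, v, u} K),
      IsLocallyFinitelyPresentableTensor C →
      ∀ (I J : C), IsFinitelyPresentable.{v} I → IsFinitelyPresentable.{v} J →
      ∀ (e : I ⟶ 𝟙_ C) (f : J ⟶ 𝟙_ C), IsIdalCover e f →
        Nonempty (LocalizationSquare C (LinearCocompleteTensorCat.Inverts e)
          (LinearCocompleteTensorCat.Inverts f)
          (LinearCocompleteTensorCat.Inverts (idalProd e f))) ∧
        ∀ S : LocalizationSquare C (LinearCocompleteTensorCat.Inverts e)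
          (LinearCocompleteTensorCat.Inverts f)
          (LinearCocompleteTensorCat.Inverts (idalProd e f)),
          IsBicategoricalPullback S.iso ∧
          GluesObjects (LinearCocompleteTensorCat.underlyingIso S.iso₁)
            (LinearCocompleteTensorCat.underlyingIso S.iso₂)) := by
  exact ⟨fun C hC I J hI hJ e f h ↦ ⟨nonempty_localizationSquare hC hI hJ h,
      isBicategoricalPullback_and_gluesObjects hC hI hJ h⟩,
    fun K _ C hC I J hI hJ e f h ↦
      ⟨LinearCocompleteTensorCat.nonempty_localizationSquare hC hI hJ h,
        LinearCocompleteTensorCat.isBicategoricalPullback_and_gluesObjects hC hI hJ h⟩⟩
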